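/- **Theorem 4.1.** Let $\theta=(\theta_n)_{n\in\mathbb Z}$ be a real weight that is a (weakly) increasing function of $|n|$ and satisfies, with constants $D,\underline d,\overline d>0$ and for all $n\in\mathbb Z$, $$1\le\theta_n,\qquad |\theta_{n+1}-\theta_n|\le D\,\theta_n,\qquad \underline d\,\theta_n\le\theta_{n+1}\le\overline d\,\theta_n .$$ Let $\ell^2_\theta$ be the space of complex sequences $u=(u_n)_{n\in\mathbb Z}$ with $\|u\|_{\ell^2_\theta}^2=\sum_{n\in\mathbb Z}\theta_n|u_n|^2<\infty$, and let $g\in\ell^2_\theta$. Let $p>1$, $F(s)=|s|^{p-1}s$, and let $\hat\alpha,\hat\beta,\hat\gamma,\hat\delta,\hat\eta,\hat\zeta\in\mathbb R$ be such that for some fixed $\epsilon>0$ $$\sigma_0:=\hat\delta-\frac{\epsilon}{2}-2\hat\beta-|\hat\alpha|D\,\underline d^{-1/2}-|\hat\beta|\Big(1+\frac{\overline d}{2}+\frac{\underline d^{-1}}{2}\Big)>0,\qquad \hat\zeta>0 .$$ Consider the lattice equation $$i\dot u_n+(\hat\alpha+i\hat\beta)(u_{n-1}-2u_n+u_{n+1})+(\hat\gamma+i\hat\delta)u_n+(\hat\eta+i\hat\zeta)F(u_n)=g_n,\quad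 u_n(0)=u_{n,0},\qquad n\in\mathbb Z. \tag{1}$$ Then (1) defines a dynamical system on $\ell^2_\theta$: for every $u_0\in\ell^2_\theta$ there is a solution $u\in C^1([0,\infty),\ell^2_\theta)$ of (1), it is unique (every $C^1([0,T],\ell^2_\theta)$-solution with the same initial state agrees with it on $[0,T]$), and the maps $S(t)u_0=u(t)$, $t\ge0$, form a semigroup of continuous maps of $\ell^2_\theta$ with continuous orbits. The semigroup $S(t)$ possesses a global attractor $\mathcal A\subset\ell^2_\theta$, that is, a compact set with $S(t)\mathcal A=\mathcal A$ for all $t\ge0$ which attracts every bounded set $\mathcal B$ of $\ell^2_\theta$ (the semidistance of $S(t)\mathcal B$ from $\mathcal A$ tends to $0$ as $t\to\infty$). Moreover $\mathcal A$ is connected, and maximal among the functional invariant sets: every $Y\subset\ell^2_\theta$ with $S(t)Y=Y$ for all $t\ge0$ is contained in $\mathcal A$. Finally, for every $\rho_1>\rho$, where $\rho^2=\|g\|^2_{\ell^2_\theta}/(2\sigma_0\epsilon)$ and $\rho\ge0$, the closed ball $\mathcal B_0$ of $\ell^2_\theta$ with center $0$ and radius $\rho_1$ is a bounded absorbing set (for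 every bounded $\mathcal B$ there is $t_0$ with $S(t)\mathcal B\subset\mathcal B_0$ for all $t\ge t_0$), and $$\mathcal A=\omega(\mathcal B_0)=\bigcap_{s\ge0}\overline{\bigcup_{t\ge s}S(t)\mathcal B_0}\subset\mathcal B_0 .$$ -/

import Mathlib

open Filter Topology

noncomputable section

/-- A weight on the lattice `ℤ`, bounded below by `1`. -/
structure LatticeWeight where
  toFun : ℤ → ℝ
  one_le : ∀ n, 1 ≤ toFun n

instance : CoeFun LatticeWeight (fun _ => ℤ → ℝ) := ⟨LatticeWeight.toFun⟩

/-- The weight is an increasing function of `|n|`, and there hold `|θ (n+1) - θ n| ≤ D θ n` and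
`dlow θ n ≤ θ (n+1) ≤ dup θ n`, with positive constants `D`, `dlow`, `dup`. Together with
`1 ≤ θ n` this is the condition (WS). -/
structure LatticeWeight.WS (θ : LatticeWeight) (D dlow dup : ℝ) : Prop where
  D_pos : 0 < D
  dlow_pos : 0 < dlow
  dup_pos : 0 < dup
  mono : ∀ m n : ℤ, |m| ≤ |n| → θ m ≤ θ n
  diff_le : ∀ n, |θ (n + 1) - θ n| ≤ D * θ n
  low_le : ∀ n, dlow * θ n ≤ θ (n + 1)
  le_up : ∀ n, θ (n + 1) ≤ dup * θ n

theorem LatticeWeight.pos (θ : LatticeWeight) (n : ℤ) : 0 < θ n :=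
  lt_of_lt_of_le one_pos (θ.one_le n)

/-- The complex sequences `u` with `∑ θ n |u n|² < ∞`, as a subspace of `ℤ → ℂ`. -/
def weightedEll2Submodule (θ : LatticeWeight) : Submodule ℂ (ℤ → ℂ) where
  carrier := {u | Summable fun n => θ n * ‖u n‖ ^ 2}
  zero_mem' := by simp [summable_zero]
  add_mem' := by
    intro u v hu hv
    refine Summable.of_nonneg_of_le (fun n => ?_) (fun n => ?_)
      ((hu.mul_left 2).add (hv.mul_left 2))
    · have := (θ.pos n).le
      positivity
    · have h1 : ‖(u + v) n‖ ≤ ‖u n‖ + ‖v n‖ := norm_add_le _ _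
      have h2 : ‖(u + v) n‖ ^ 2 ≤ (‖u n‖ + ‖v n‖) ^ 2 := by gcongr
      have h3 : ‖(u + v) n‖ ^ 2 ≤ 2 * ‖u n‖ ^ 2 + 2 * ‖v n‖ ^ 2 := by
        nlinarith [sq_nonneg (‖u n‖ - ‖v n‖)]
      calc θ n * ‖(u + v) n‖ ^ 2 ≤ θ n * (2 * ‖u n‖ ^ 2 + 2 * ‖v n‖ ^ 2) :=
            mul_le_mul_of_nonneg_left h3 (θ.pos n).le
        _ = _ := by ring
  smul_mem' := by
    intro c u hu
    have h : Summable fun n => ‖c‖ ^ 2 * (θ n * ‖u n‖ ^ 2) := Summable.mul_left _ hu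
    refine h.congr (fun n => ?_)
    simp only [Pi.smul_apply, smul_eq_mul, norm_mul]
    ring

/-- The weighted space `ℓ²_θ`. It is a definition of its own, so that it does not inherit the
product topology of `ℤ → ℂ`. -/
def WeightedEll2 (θ : LatticeWeight) : Type := weightedEll2Submodule θ

namespace WeightedEll2

variable {θ : LatticeWeight}

instance : AddCommGroup (WeightedEll2 θ) := inferInstanceAs (AddCommGroup (weightedEll2Submodule θ))

instance : Module ℂ (WeightedEll2 θ) := inferInstanceAs (Module ℂ (weightedEll2Submodule θ))

instance : CoeFun (WeightedEll2 θ) (fun _ => ℤ → ℂ) := ⟨Subtype.val⟩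

theorem summable_sq (u : WeightedEll2 θ) : Summable fun n => θ n * ‖u n‖ ^ 2 := u.2

theorem ext {u v : WeightedEll2 θ} (h : ∀ n, u n = v n) : u = v := Subtype.ext (funext h)

theorem add_apply (u v : WeightedEll2 θ) (n : ℤ) : (u + v) n = u n + v n := rfl

theorem smul_apply (c : ℂ) (u : WeightedEll2 θ) (n : ℤ) : (c • u) n = c * u n := rfl

theorem zero_apply (n : ℤ) : (0 : WeightedEll2 θ) n = 0 := rfl

theorem summable_inner (u v : WeightedEll2 θ) :
    Summable fun n => (θ n : ℂ) * (starRingEnd ℂ (u n) * v n) := by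
  refine Summable.of_norm_bounded (g := fun n => θ n * ‖u n‖ ^ 2 + θ n * ‖v n‖ ^ 2)
    (u.summable_sq.add v.summable_sq) (fun n => ?_)
  have h := (θ.pos n).le
  rw [norm_mul, norm_mul, RCLike.norm_conj, Complex.norm_real, Real.norm_of_nonneg h]
  have : ‖u n‖ * ‖v n‖ ≤ ‖u n‖ ^ 2 + ‖v n‖ ^ 2 := by
    nlinarith [sq_nonneg (‖u n‖ - ‖v n‖), norm_nonneg (u n), norm_nonneg (v n)]
  calc θ n * (‖u n‖ * ‖v n‖) ≤ θ n * (‖u n‖ ^ 2 + ‖v n‖ ^ 2) := mul_le_mul_of_nonneg_left this h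
    _ = _ := by ring

theorem inner_self_term (u : WeightedEll2 θ) (n : ℤ) :
    (θ n : ℂ) * (starRingEnd ℂ (u n) * u n) = ((θ n * ‖u n‖ ^ 2 : ℝ) : ℂ) := by
  rw [Complex.conj_mul']
  push_cast
  ring

/-- The scalar product `∑ θ n (conj (u n)) (v n)` of `ℓ²_θ`. -/
abbrev core (θ : LatticeWeight) : InnerProductSpace.Core ℂ (WeightedEll2 θ) where
  inner u v := ∑' n, (θ n : ℂ) * (starRingEnd ℂ (u n) * v n)
  conj_inner_symm u v := by
    rw [Complex.conj_tsum]
    refine tsum_congr (fun n => ?_)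
    simp only [map_mul, Complex.conj_ofReal, Complex.conj_conj]
    ring
  re_inner_nonneg u := by
    simp only [inner_self_term]
    rw [← Complex.ofReal_tsum]
    exact tsum_nonneg (fun n => mul_nonneg (θ.pos n).le (sq_nonneg _))
  add_left u v w := by
    rw [← (summable_inner u w).tsum_add (summable_inner v w)]
    refine tsum_congr (fun n => ?_)
    rw [add_apply, map_add]
    ring
  smul_left u v c := by
    rw [← tsum_mul_left]
    refine tsum_congr (fun n => ?_)
    rw [smul_apply, map_mul]
    ring
  definite u h := by
    simp only [inner_self_term] at h
    rw [← Complex.ofReal_tsum, Complex.ofReal_eq_zero] at h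
    have h0 := (hasSum_zero_iff_of_nonneg
      (fun n => mul_nonneg (θ.pos n).le (sq_nonneg ‖u n‖))).1 (h ▸ u.summable_sq.hasSum)
    refine ext (fun n => ?_)
    have hn : θ n * ‖u n‖ ^ 2 = 0 := congrFun h0 n
    have := (θ.pos n).ne'
    simpa [this, zero_apply] using hn

instance : NormedAddCommGroup (WeightedEll2 θ) :=
  @InnerProductSpace.Core.toNormedAddCommGroup ℂ _ _ _ _ (core θ)

instance : InnerProductSpace ℂ (WeightedEll2 θ) := InnerProductSpace.ofCore (core θ).toCore

/-- The norm of `ℓ²_θ` is the expected one. -/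
theorem norm_sq_eq (u : WeightedEll2 θ) : ‖u‖ ^ 2 = ∑' n, θ n * ‖u n‖ ^ 2 := by
  have h : inner ℂ u u = ∑' n, (θ n : ℂ) * (starRingEnd ℂ (u n) * u n) := rfl
  simp only [inner_self_term] at h
  rw [← Complex.ofReal_tsum, inner_self_eq_norm_sq_to_K] at h
  apply Complex.ofReal_injective
  rw [← h]
  simp

end WeightedEll2

/-- The parameters of the complex lattice equation: `(α + iβ)`, `(γ + iδ)` and `(η + iζ)` are the
coefficients of the discrete Laplacian, of the linear term and of the nonlinearity
`F s = |s|^(p-1) s`. -/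
structure LatticeParams where
  α : ℝ
  β : ℝ
  γ : ℝ
  δ : ℝ
  η : ℝ
  ζ : ℝ
  p : ℝ

namespace LatticeParams

/-- The gauge nonlinearity `F s = |s|^(p-1) s`. -/
def F (P : LatticeParams) (s : ℂ) : ℂ := ((‖s‖ ^ (P.p - 1) : ℝ) : ℂ) * s

/-- `σ₀ = δ - ε/2 - 2β - |α| D dlow^(-1/2) - |β| (1 + dup/2 + dlow⁻¹/2)`. -/
def sigma0 (P : LatticeParams) (ε D dlow dup : ℝ) : ℝ :=
  P.δ - ε / 2 - 2 * P.β - |P.α| * D * dlow ^ (-(1 / 2) : ℝ)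
    - |P.β| * (1 + dup / 2 + dlow⁻¹ / 2)

/-- `u` is a `C¹` solution on the time interval `J` (with `0 ∈ J`), with values in `ℓ²_θ`, of
`i u̇ₙ + (α + iβ)(uₙ₋₁ - 2uₙ + uₙ₊₁) + (γ + iδ) uₙ + (η + iζ) F(uₙ) = gₙ`, `n ∈ ℤ`, with
`u(0) = u₀`. Here `du` is the derivative of `u` in the norm of `ℓ²_θ`, one-sided at
end points of `J`. -/
def IsSolutionOn (P : LatticeParams) {θ : LatticeWeight} (g u₀ : WeightedEll2 θ) (J : Set ℝ)
    (u : ℝ → WeightedEll2 θ) : Prop :=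
  u 0 = u₀ ∧ ∃ du : ℝ → WeightedEll2 θ, ContinuousOn du J ∧
    ∀ t ∈ J, HasDerivWithinAt u (du t) J t ∧
      ∀ n : ℤ,
        Complex.I * du t n
          + ((P.α : ℂ) + Complex.I * P.β) * (u t (n - 1) - 2 * u t n + u t (n + 1))
          + ((P.γ : ℂ) + Complex.I * P.δ) * u t n
          + ((P.η : ℂ) + Complex.I * P.ζ) * P.F (u t n) = g n

/-- `S` is the solution operator of the lattice equation: for each initial state `u₀`, the orbit
`t ↦ S t u₀` is a solution on `[0, ∞)`, and every solution on some `[0, T]` with the same initial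
state coincides with it there. Only the values `S t` with `t ≥ 0` matter; they are determined by
this property. -/
def IsSolutionOperator (P : LatticeParams) {θ : LatticeWeight} (g : WeightedEll2 θ)
    (S : ℝ → WeightedEll2 θ → WeightedEll2 θ) : Prop :=
  ∀ u₀ : WeightedEll2 θ, P.IsSolutionOn g u₀ (Set.Ici 0) (fun t => S t u₀) ∧
    ∀ T : ℝ, 0 < T → ∀ v : ℝ → WeightedEll2 θ, P.IsSolutionOn g u₀ (Set.Icc 0 T) v →
      Set.EqOn v (fun t => S t u₀) (Set.Icc 0 T)

end LatticeParams

section DynamicalSystems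

variable {X : Type*} [MetricSpace X]

/-- A semigroup `S t`, `t ≥ 0`, of continuous maps, with continuous orbits. -/
structure IsContinuousSemigroup (S : ℝ → X → X) : Prop where
  zero : ∀ x, S 0 x = x
  add : ∀ s t : ℝ, 0 ≤ s → 0 ≤ t → ∀ x, S (s + t) x = S s (S t x)
  continuous_map : ∀ t : ℝ, 0 ≤ t → Continuous (S t)
  continuous_orbit : ∀ x, ContinuousOn (fun t => S t x) (Set.Ici 0)

/-- `Y` is a functional invariant set: `S t Y = Y` for all `t ≥ 0`. -/
def IsFunctionalInvariant (S : ℝ → X → X) (Y : Set X) : Prop :=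
  ∀ t : ℝ, 0 ≤ t → S t '' Y = Y

/-- `B₀` is a bounded absorbing set: it is bounded, and for every bounded set `B` there is a time
from which on `S t B ⊆ B₀`. -/
def IsBoundedAbsorbing (S : ℝ → X → X) (B₀ : Set X) : Prop :=
  Bornology.IsBounded B₀ ∧ ∀ B : Set X, Bornology.IsBounded B →
    ∃ t₀ : ℝ, 0 ≤ t₀ ∧ ∀ t : ℝ, t₀ ≤ t → S t '' B ⊆ B₀

/-- `A` is a global attractor: it is compact, functional invariant, and attracts every bounded set
`B`, that is, the semidistance of `S t B` from `A` tends to `0` as `t → ∞`. -/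
structure IsGlobalAttractor (S : ℝ → X → X) (A : Set X) : Prop where
  compact : IsCompact A
  invariant : IsFunctionalInvariant S A
  attracts : ∀ B : Set X, Bornology.IsBounded B → ∀ r : ℝ, 0 < r →
    ∃ t₀ : ℝ, 0 ≤ t₀ ∧ ∀ t : ℝ, t₀ ≤ t → S t '' B ⊆ Metric.thickening r A

end DynamicalSystems

end

/-! Solved for the time derivative, the lattice equation is an ordinary differential equation in the
Hilbert space `ℓ²_θ` with a field that is Lipschitz on balls. Everything rests on one energy
inequality, `tsum_weight_mul_re_field_le`. Write `E_w(u) = ∑ w n |u n|²`. For a positive weight `w ≤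
θ` whose increments and neighbour quotients are controlled, testing the equation with `w n * conj (u
n)` gives `½ (E_w(u))' ≤ -σ E_w(u) - ζ ∑ w n |u n|^(p+1) + E_w(g) / (2ε)`, where `σ` is `sigma0` at
the constants of `w`. The `α` part of the Laplacian telescopes up to the increments of `w`. Since
`sigma0` is continuous in these constants and positive at those of `θ`, slightly tilted weights keep
a positive rate. Three weights are used.

With `w = θ` the equation is dissipative: solutions are global, and balls of every radius above `ρ`
absorb.

With `w = θ * outerWeight`, tiny near the origin and equal to `θ` far out, the tails of solutions
become uniformly small. This is asymptotic compactness (`isAsymptoticallyCompact`), so the ω-limit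
set of an absorbing ball is a global attractor. It is connected because the ball is.

With the summable weight `w n = min (θ n) c * exp (-κ |n|)`, Jensen's inequality makes the damping
superlinear in `E_w`, so `E_w` at time `1` is bounded regardless of the initial state. On an
invariant set, where every point has arbitrarily remote pasts, this leaves only the bound by the
forcing; `κ → 0` turns it into a norm bound. Hence every invariant set is bounded
(`isBounded_of_isFunctionalInvariant`) and lies in the attractor. -/

noncomputable section

/-! ### Differential inequalities for real functions -/

section ScalarInequalities

variable {y y' : ℝ → ℝ} {a b : ℝ}

theorem le_of_deriv_right_nonpos_above {Y : ℝ} (hy : ContinuousOn y (Set.Icc a b))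
    (hy' : ∀ x ∈ Set.Ico a b, HasDerivWithinAt y (y' x) (Set.Ici x) x)
    (h : ∀ x ∈ Set.Ico a b, Y < y x → y' x ≤ 0) (ha : y a ≤ Y) :
    ∀ x ∈ Set.Icc a b, y x ≤ Y := by
  intro x hx
  -- The barrier has slope `η > 0` and stays strictly above `Y`, so at a contact point `y' ≤ 0 < η`;
  -- then `η → 0`.
  have key : ∀ η : ℝ, 0 < η → y x ≤ Y + η * (1 + (x - a)) := by
    intro η hη
    refine image_le_of_deriv_right_lt_deriv_boundary hy hy'
      (B := fun x => Y + η * (1 + (x - a))) (B' := fun _ => η) ?_ ?_ ?_ hx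
    · simp; linarith
    · intro z
      have := ((((hasDerivAt_id z).sub_const a).const_add 1).const_mul η).const_add Y
      simpa using this
    · intro z hz hzy
      have : Y < y z := by
        rw [hzy]
        have : 0 < η * (1 + (z - a)) := mul_pos hη (by linarith [hz.1])
        linarith
      linarith [h z hz this]
  have hc : Tendsto (fun η : ℝ => Y + η * (1 + (x - a))) (𝓝[>] 0) (𝓝 (Y + 0 * (1 + (x - a)))) := by
    apply Tendsto.mono_left _ nhdsWithin_le_nhds
    exact Continuous.tendsto (by fun_prop) 0
  rw [zero_mul, add_zero] at hc
  exact ge_of_tendsto hc (eventually_mem_nhdsWithin.mono fun η hη => key η hη)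

/-- Grönwall's inequality with the negative rate `-k`; a nonpositive term of the bound is dropped.
-/
theorem le_exp_decay_of_deriv_right_le {k c : ℝ} (hk : 0 < k) (hc : 0 ≤ c)
    (hy : ContinuousOn y (Set.Icc a b))
    (hy' : ∀ x ∈ Set.Ico a b, HasDerivWithinAt y (y' x) (Set.Ici x) x)
    (h : ∀ x ∈ Set.Ico a b, y' x ≤ -k * y x + c) :
    ∀ x ∈ Set.Icc a b, y x ≤ y a * Real.exp (-k * (x - a)) + c / k := by
  intro x hx
  have := le_gronwallBound_of_liminf_deriv_right_le hy
    (fun x hx _ hr => (hy' x hx).liminf_right_slope_le hr) le_rfl h x hx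
  rw [gronwallBound_of_K_ne_0 (by linarith : -k ≠ 0)] at this
  refine this.trans ?_
  have h1 : c / -k * (Real.exp (-k * (x - a)) - 1)
      = c / k - c / k * Real.exp (-k * (x - a)) := by
    field_simp
    ring
  have : 0 ≤ c / k * Real.exp (-k * (x - a)) := by positivity
  simp only [h1]
  linarith

/-- Solutions of `y' ≤ -k y + c - b₀ y ^ q`, `q > 1`, are bounded at time `1` independently of
their initial value. -/
theorem le_of_superlinear_damping {k c b₀ q : ℝ} (hk : 0 < k) (hc : 0 ≤ c) (hb₀ : 0 < b₀)
    (hq : 1 < q) (hy : ContinuousOn y (Set.Icc 0 1)) (hy0 : ∀ x, 0 ≤ y x)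
    (hy' : ∀ x ∈ Set.Ico 0 1, HasDerivWithinAt y (y' x) (Set.Ici x) x)
    (h : ∀ x ∈ Set.Ico 0 1, y' x ≤ -k * y x + c - b₀ * y x ^ q) :
    y 1 ≤ max (c / k) (((q - 1) * b₀) ^ (-(q - 1)⁻¹)) := by
  -- Once below `c / k`, `y` stays there. Otherwise `c - k y < 0` throughout, so `y' ≤ -b₀ y ^ q`,
  -- and `y ^ (-(q - 1))` grows at least at the rate `(q - 1) b₀` from a nonnegative value.
  by_cases hs : ∃ s ∈ Set.Icc (0 : ℝ) 1, y s ≤ c / k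
  · obtain ⟨s, hs, hys⟩ := hs
    refine le_trans ?_ (le_max_left _ _)
    refine le_of_deriv_right_nonpos_above (a := s) (b := 1) (y' := y')
      (hy.mono (Set.Icc_subset_Icc_left hs.1))
      (fun x hx => hy' x ⟨hs.1.trans hx.1, hx.2⟩) ?_ hys 1 ⟨hs.2, le_rfl⟩
    intro x hx hxc
    have h1 := h x ⟨hs.1.trans hx.1, hx.2⟩
    have h2 : 0 ≤ b₀ * y x ^ q := mul_nonneg hb₀.le (Real.rpow_nonneg (hy0 x) _)
    rw [div_lt_iff₀ hk] at hxc
    linarith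
  · push Not at hs
    refine le_trans ?_ (le_max_right _ _)
    have hpos : ∀ s ∈ Set.Icc (0 : ℝ) 1, 0 < y s := fun s hs' =>
      lt_of_le_of_lt (by positivity) (hs s hs')
    have key : ∀ x ∈ Set.Icc (0 : ℝ) 1, -(y x ^ (-(q - 1))) ≤ -((q - 1) * b₀ * x) := by
      intro x hx
      refine image_le_of_deriv_right_le_deriv_boundary (a := 0) (b := 1)
        (f := fun x => -(y x ^ (-(q - 1)))) (B := fun x => -((q - 1) * b₀ * x))
        (f' := fun x => -(y' x * (-(q - 1)) * y x ^ (-(q - 1) - 1)))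
        (B' := fun _ => -((q - 1) * b₀)) ?_ ?_ ?_ ?_ ?_ ?_ hx
      · exact (hy.rpow_const fun s hs' => Or.inl (hpos s hs').ne').neg
      · intro s hs'
        exact ((hy' s hs').rpow_const (Or.inl (hpos s ⟨hs'.1, hs'.2.le⟩).ne')).neg
      · simp [Real.rpow_nonneg (hy0 0)]
      · fun_prop
      · intro s _
        have := ((hasDerivAt_id s).const_mul ((q - 1) * b₀)).neg.hasDerivWithinAt (s := Set.Ici s)
        rw [mul_one] at this
        exact this
      · intro s hs'
        have hp := hpos s ⟨hs'.1, hs'.2.le⟩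
        have h1 := h s hs'
        have h2 := hs s ⟨hs'.1, hs'.2.le⟩
        rw [div_lt_iff₀ hk] at h2
        have h3 : y' s ≤ - (b₀ * y s ^ q) := by linarith
        have h4 : y s ^ q * y s ^ (-(q - 1) - 1) = 1 := by
          rw [← Real.rpow_add hp]
          simp
        have h5 : 0 ≤ (q - 1) * y s ^ (-(q - 1) - 1) :=
          mul_nonneg (by linarith) (Real.rpow_nonneg hp.le _)
        have h6 := mul_le_mul_of_nonneg_right h3 h5
        calc -(y' s * (-(q - 1)) * y s ^ (-(q - 1) - 1))
            = y' s * ((q - 1) * y s ^ (-(q - 1) - 1)) := by ring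
          _ ≤ _ := h6
          _ = -((q - 1) * b₀ * (y s ^ q * y s ^ (-(q - 1) - 1))) := by ring
          _ = _ := by rw [h4, mul_one]
    have h1 := key 1 ⟨zero_le_one, le_rfl⟩
    rw [mul_one, neg_le_neg_iff] at h1
    have hp := hpos 1 ⟨zero_le_one, le_rfl⟩
    have hqb : 0 < (q - 1) * b₀ := mul_pos (by linarith) hb₀
    have h2 := Real.rpow_le_rpow_of_nonpos hqb h1
      (by rw [neg_nonpos, inv_nonneg]; linarith : -(q - 1)⁻¹ ≤ 0)
    rw [← Real.rpow_mul hp.le] at h2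
    have h3 : -(q - 1) * -(q - 1)⁻¹ = 1 := by
      have : q - 1 ≠ 0 := by linarith
      field_simp
    rwa [h3, Real.rpow_one] at h2

end ScalarInequalities

/-! ### Dissipative differential equations in an inner product space -/

section AbstractODE

variable {H : Type*} [NormedAddCommGroup H] [InnerProductSpace ℝ H]

/-- `u` is a solution of the autonomous equation `u' = f u` on `J`. -/
def IsTrajectoryOn (f : H → H) (J : Set ℝ) (u : ℝ → H) : Prop :=
  ∀ t ∈ J, HasDerivWithinAt u (f (u t)) J t

namespace IsTrajectoryOn

variable {f : H → H} {u v : ℝ → H} {J : Set ℝ} {T : ℝ}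

theorem continuousOn (hu : IsTrajectoryOn f J u) : ContinuousOn u J :=
  fun t ht => (hu t ht).continuousWithinAt

theorem hasDerivWithinAt_right (hu : IsTrajectoryOn f (Set.Icc 0 T) u) {t : ℝ}
    (ht : t ∈ Set.Ico 0 T) : HasDerivWithinAt u (f (u t)) (Set.Ici t) t :=
  (hu t ⟨ht.1, ht.2.le⟩).mono_of_mem_nhdsWithin (Icc_mem_nhdsGE_of_mem ht)

theorem mono {J' : Set ℝ} (hu : IsTrajectoryOn f J u) (h : J' ⊆ J) : IsTrajectoryOn f J' u :=
  fun t ht => (hu t (h ht)).mono h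

theorem shift (hu : IsTrajectoryOn f (Set.Ici 0) u) {s : ℝ} (hs : 0 ≤ s) :
    IsTrajectoryOn f (Set.Ici 0) (fun t => u (t + s)) := by
  intro t ht
  have h1 := hu (t + s) (add_nonneg ht hs)
  have h2 : HasDerivWithinAt (fun t => t + s) 1 (Set.Ici 0) t :=
    ((hasDerivAt_id t).add_const s).hasDerivWithinAt
  have := h1.scomp t h2 (fun x hx => add_nonneg hx hs)
  rwa [one_smul] at this

/-- The derivative of `‖u‖²` is `2 ⟪u, f u⟫`, so the norm cannot grow outside the ball. -/
theorem norm_sq_le (hu : IsTrajectoryOn f (Set.Icc 0 T) u) {Y : ℝ}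
    (hf : ∀ x, Y < ‖x‖ ^ 2 → inner ℝ x (f x) ≤ 0) (h0 : ‖u 0‖ ^ 2 ≤ Y) :
    ∀ t ∈ Set.Icc 0 T, ‖u t‖ ^ 2 ≤ Y :=
  le_of_deriv_right_nonpos_above (y := fun t => ‖u t‖ ^ 2) (hu.continuousOn.norm.pow 2)
    (fun _ hx => (hu.hasDerivWithinAt_right hx).norm_sq)
    (fun x _ hxY => by have := hf _ hxY; linarith) h0

/-- By compactness of `[0, T]` both trajectories lie in one ball, where `f` has a Lipschitz
constant. -/
theorem eqOn (hf : ∀ R : ℝ, ∃ K : NNReal, LipschitzOnWith K f (Metric.closedBall 0 R))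
    (hu : IsTrajectoryOn f (Set.Icc 0 T) u) (hv : IsTrajectoryOn f (Set.Icc 0 T) v)
    (h0 : u 0 = v 0) : Set.EqOn u v (Set.Icc 0 T) := by
  obtain ⟨R₁, h₁⟩ := (isCompact_Icc.image_of_continuousOn hu.continuousOn).isBounded.subset_closedBall 0
  obtain ⟨R₂, h₂⟩ := (isCompact_Icc.image_of_continuousOn hv.continuousOn).isBounded.subset_closedBall 0
  obtain ⟨K, hK⟩ := hf (max R₁ R₂)
  refine ODE_solution_unique_of_mem_Icc_right (v := fun _ => f)
    (s := fun _ => Metric.closedBall 0 (max R₁ R₂)) (fun _ _ => hK)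
    hu.continuousOn (fun _ ht => hu.hasDerivWithinAt_right ht) (fun t ht => ?_)
    hv.continuousOn (fun _ ht => hv.hasDerivWithinAt_right ht) (fun t ht => ?_) h0
  · exact Metric.closedBall_subset_closedBall (le_max_left _ _)
      (h₁ (Set.mem_image_of_mem _ ⟨ht.1, ht.2.le⟩))
  · exact Metric.closedBall_subset_closedBall (le_max_right _ _)
      (h₂ (Set.mem_image_of_mem _ ⟨ht.1, ht.2.le⟩))

end IsTrajectoryOn

/-- The piecewise linear function equal to `1` up to `R` and to `0` from `R + 1` on. -/
def linearCutoff (R s : ℝ) : ℝ := max 0 (min 1 (R + 1 - s))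

theorem linearCutoff_nonneg (R s : ℝ) : 0 ≤ linearCutoff R s := le_max_left _ _

theorem linearCutoff_le_one (R s : ℝ) : linearCutoff R s ≤ 1 :=
  max_le zero_le_one (min_le_left _ _)

theorem linearCutoff_eq_one {R s : ℝ} (h : s ≤ R) : linearCutoff R s = 1 := by
  rw [linearCutoff, min_eq_left (by linarith), max_eq_right zero_le_one]

theorem linearCutoff_eq_zero {R s : ℝ} (h : R + 1 ≤ s) : linearCutoff R s = 0 := by
  rw [linearCutoff, max_eq_left]
  exact (min_le_right _ _).trans (by linarith)

theorem abs_linearCutoff_sub_le (R s t : ℝ) :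
    |linearCutoff R s - linearCutoff R t| ≤ |s - t| := by
  unfold linearCutoff
  rw [max_comm 0, max_comm 0]
  refine (abs_max_sub_max_le_abs _ _ _).trans ?_
  have := abs_min_sub_min_le_max (1 : ℝ) (R + 1 - s) 1 (R + 1 - t)
  refine this.trans (max_le (by simp) ?_)
  rw [show R + 1 - s - (R + 1 - t) = t - s by ring, abs_sub_comm]

/-- The difference splits into (difference of cutoffs) `• f x` plus (cutoff at `z`) `• (f x - f z)`.
Both are controlled when `x` is in the ball; by symmetry one of the points may be assumed there,
since otherwise both values vanish. -/
theorem lipschitzWith_linearCutoff_smul {f : H → H} {R : ℝ} {K L : NNReal}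
    (hK : LipschitzOnWith K f (Metric.closedBall 0 (R + 1)))
    (hL : ∀ x ∈ Metric.closedBall (0 : H) (R + 1), ‖f x‖ ≤ L) :
    LipschitzWith (L + K) (fun x => linearCutoff R ‖x‖ • f x) := by
  have hout : ∀ x : H, x ∉ Metric.closedBall (0 : H) (R + 1) → linearCutoff R ‖x‖ = 0 := by
    intro x hx
    rw [mem_closedBall_zero_iff, not_le] at hx
    exact linearCutoff_eq_zero hx.le
  have hcut : ∀ x z : H, |linearCutoff R ‖x‖ - linearCutoff R ‖z‖| ≤ ‖x - z‖ := fun x z =>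
    (abs_linearCutoff_sub_le _ _ _).trans (abs_norm_sub_norm_le _ _)
  have main : ∀ x z : H, x ∈ Metric.closedBall (0 : H) (R + 1) →
      ‖linearCutoff R ‖x‖ • f x - linearCutoff R ‖z‖ • f z‖ ≤ (L + K) * ‖x - z‖ := by
    intro x z hx
    have h1 : ‖(linearCutoff R ‖x‖ - linearCutoff R ‖z‖) • f x‖ ≤ L * ‖x - z‖ := by
      rw [norm_smul, mul_comm]
      exact mul_le_mul (hL x hx) (hcut x z) (norm_nonneg _) L.2
    have h2 : ‖linearCutoff R ‖z‖ • (f x - f z)‖ ≤ K * ‖x - z‖ := by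
      by_cases hz : z ∈ Metric.closedBall (0 : H) (R + 1)
      · have := hK.dist_le_mul x hx z hz
        rw [dist_eq_norm, dist_eq_norm] at this
        rw [norm_smul, Real.norm_of_nonneg (linearCutoff_nonneg _ _)]
        calc _ ≤ 1 * ‖f x - f z‖ := by gcongr; exact linearCutoff_le_one _ _
          _ ≤ _ := by rw [one_mul]; exact this
      · rw [hout z hz, zero_smul, norm_zero]; positivity
    calc _ = ‖(linearCutoff R ‖x‖ - linearCutoff R ‖z‖) • f x
          + linearCutoff R ‖z‖ • (f x - f z)‖ := by
            congr 1; rw [sub_smul, smul_sub]; abel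
      _ ≤ _ := norm_add_le _ _
      _ ≤ _ := by linarith
  refine LipschitzWith.of_dist_le_mul fun x z => ?_
  rw [dist_eq_norm, dist_eq_norm, NNReal.coe_add]
  by_cases hx : x ∈ Metric.closedBall (0 : H) (R + 1)
  · exact main x z hx
  · by_cases hz : z ∈ Metric.closedBall (0 : H) (R + 1)
    · rw [norm_sub_rev, norm_sub_rev x]
      exact main z x hz
    · rw [hout x hx, hout z hz]
      simp only [zero_smul, sub_zero, norm_zero]
      positivity

theorem exists_trajectoryOn_of_lipschitz_bounded [CompleteSpace H] {f : H → H} {K L : NNReal}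
    (hK : LipschitzWith K f) (hL : ∀ x, ‖f x‖ ≤ L) (u₀ : H) {T : ℝ} (hT : 0 ≤ T) :
    ∃ u : ℝ → H, u 0 = u₀ ∧ IsTrajectoryOn f (Set.Icc 0 T) u := by
  lift T to NNReal using hT with T'
  have hT := T'.coe_nonneg
  -- The radius `L * T'` is the farthest a trajectory of speed at most `L` can travel, so no
  -- smallness of the time interval is needed.
  have hPL : IsPicardLindelof (fun _ => f) (⟨0, Set.left_mem_Icc.2 hT⟩ : Set.Icc (0 : ℝ) T') u₀
      (L * T') 0 L K :=
    { lipschitzOnWith := fun _ _ => hK.lipschitzOnWith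
      continuousOn := fun _ _ => continuousOn_const
      norm_le := fun _ _ x _ => hL x
      mul_max_le := by simp }
  exact hPL.exists_eq_forall_mem_Icc_hasDerivWithinAt₀

variable {f : H → H} {σ c : ℝ}

theorem inner_nonpos_of_dissipative (hσ : 0 < σ) (hdiss : ∀ x, inner ℝ x (f x) ≤ -σ * ‖x‖ ^ 2 + c)
    {Y : ℝ} (hY : c / σ ≤ Y) (x : H) (hx : Y < ‖x‖ ^ 2) : inner ℝ x (f x) ≤ 0 := by
  have h1 := hdiss x
  have h2 := hY.trans_lt hx
  rw [div_lt_iff₀ hσ] at h2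
  linarith

/-- The cut-off field is bounded and globally Lipschitz, hence solvable on all of `[0, T]`. A
nonnegative factor keeps the sign of `⟪x, f x⟫`, so the solution never leaves the ball where the
cutoff is `1` and solves the original equation. -/
theorem exists_trajectoryOn_Icc [CompleteSpace H]
    (hf : ∀ R : ℝ, ∃ K : NNReal, LipschitzOnWith K f (Metric.closedBall 0 R))
    (hσ : 0 < σ) (hdiss : ∀ x, inner ℝ x (f x) ≤ -σ * ‖x‖ ^ 2 + c) (u₀ : H) {T : ℝ} (hT : 0 ≤ T) :
    ∃ u : ℝ → H, u 0 = u₀ ∧ IsTrajectoryOn f (Set.Icc 0 T) u := by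
  set Y := max (‖u₀‖ ^ 2) (c / σ) with hY
  have hY0 : 0 ≤ Y := (sq_nonneg _).trans (le_max_left _ _)
  set R := Real.sqrt Y with hR
  have hR0 : 0 ≤ R := Real.sqrt_nonneg _
  obtain ⟨K, hK⟩ := hf (R + 1)
  set L : NNReal := ⟨‖f 0‖ + K * (R + 1), by positivity⟩ with hLdef
  have hL : ∀ x ∈ Metric.closedBall (0 : H) (R + 1), ‖f x‖ ≤ L := by
    intro x hx
    have h1 := hK.dist_le_mul x hx 0 (Metric.mem_closedBall_self (by linarith))
    rw [dist_eq_norm, dist_zero_right] at h1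
    rw [mem_closedBall_zero_iff] at hx
    have h2 : ‖f x‖ ≤ ‖f 0‖ + ‖f x - f 0‖ := norm_le_insert' _ _
    have h3 : (K : ℝ) * ‖x‖ ≤ K * (R + 1) := by gcongr
    change _ ≤ ‖f 0‖ + K * (R + 1)
    linarith
  have hbdd : ∀ x, ‖linearCutoff R ‖x‖ • f x‖ ≤ L := by
    intro x
    rw [norm_smul, Real.norm_of_nonneg (linearCutoff_nonneg _ _)]
    by_cases hx : x ∈ Metric.closedBall (0 : H) (R + 1)
    · calc _ ≤ 1 * (L : ℝ) := by
            gcongr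
            · exact linearCutoff_le_one _ _
            · exact hL x hx
        _ = L := one_mul _
    · rw [mem_closedBall_zero_iff, not_le] at hx
      rw [linearCutoff_eq_zero hx.le, zero_mul]
      exact L.2
  obtain ⟨u, hu0, hu⟩ := exists_trajectoryOn_of_lipschitz_bounded
    (lipschitzWith_linearCutoff_smul hK hL) hbdd u₀ hT
  have hbound : ∀ t ∈ Set.Icc 0 T, ‖u t‖ ^ 2 ≤ Y := by
    refine hu.norm_sq_le (fun x hx => ?_) (by rw [hu0]; exact le_max_left _ _)
    rw [inner_smul_right]
    exact mul_nonpos_of_nonneg_of_nonpos (linearCutoff_nonneg _ _)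
      (inner_nonpos_of_dissipative hσ hdiss (le_max_right _ _) x hx)
  refine ⟨u, hu0, fun t ht => ?_⟩
  have h1 : HasDerivWithinAt u (linearCutoff R ‖u t‖ • f (u t)) (Set.Icc 0 T) t := hu t ht
  rwa [linearCutoff_eq_one (Real.le_sqrt_of_sq_le (hbound t ht)), one_smul] at h1

theorem exists_trajectoryOn_Ici [CompleteSpace H]
    (hf : ∀ R : ℝ, ∃ K : NNReal, LipschitzOnWith K f (Metric.closedBall 0 R))
    (hσ : 0 < σ) (hdiss : ∀ x, inner ℝ x (f x) ≤ -σ * ‖x‖ ^ 2 + c) (u₀ : H) :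
    ∃ u : ℝ → H, u 0 = u₀ ∧ IsTrajectoryOn f (Set.Ici 0) u := by
  choose w hw0 hw using fun n : ℕ =>
    exists_trajectoryOn_Icc hf hσ hdiss u₀ (T := n) (Nat.cast_nonneg n)
  have hagree : ∀ m n : ℕ, ∀ t : ℝ, 0 ≤ t → t ≤ m → t ≤ n → w m t = w n t := by
    intro m n t h0 hm hn
    exact IsTrajectoryOn.eqOn hf ((hw m).mono (Set.Icc_subset_Icc_right hm))
      ((hw n).mono (Set.Icc_subset_Icc_right hn)) (by rw [hw0, hw0]) ⟨h0, le_rfl⟩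
  set u : ℝ → H := fun t => w ⌈t⌉₊ t with hu
  have hun : ∀ n : ℕ, ∀ t ∈ Set.Icc (0 : ℝ) n, u t = w n t := fun n t ht =>
    hagree _ _ t ht.1 (Nat.le_ceil t) ht.2
  refine ⟨u, by simp [hu, hw0], fun t ht => ?_⟩
  have ht0 : (0 : ℝ) ≤ t := ht
  -- The extra `1` makes `t < n` strict, so that `[0, n]` is a neighbourhood of `t` within `[0, ∞)`.
  set n : ℕ := ⌈t⌉₊ + 1
  have htn : t < n := by
    have := Nat.le_ceil t
    push_cast [n]
    linarith
  have h1 : HasDerivWithinAt u (f (u t)) (Set.Icc 0 n) t := by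
    rw [hun n t ⟨ht0, htn.le⟩]
    exact (hw n t ⟨ht0, htn.le⟩).congr (hun n) (hun n t ⟨ht0, htn.le⟩)
  refine h1.mono_of_mem_nhdsWithin ?_
  filter_upwards [self_mem_nhdsWithin, mem_nhdsWithin_of_mem_nhds (Iio_mem_nhds htn)] with x hx hx'
  exact ⟨hx, le_of_lt hx'⟩

/-- A dissipative equation whose right hand side is Lipschitz on balls defines a semigroup. -/
theorem exists_semigroup_of_dissipative [CompleteSpace H]
    (hf : ∀ R : ℝ, ∃ K : NNReal, LipschitzOnWith K f (Metric.closedBall 0 R))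
    (hσ : 0 < σ) (hdiss : ∀ x, inner ℝ x (f x) ≤ -σ * ‖x‖ ^ 2 + c) :
    ∃ S : ℝ → H → H, IsContinuousSemigroup S ∧
      ∀ x, IsTrajectoryOn f (Set.Ici 0) (fun t => S t x) := by
  choose w hw0 hw using exists_trajectoryOn_Ici hf hσ hdiss
  refine ⟨fun t x => w x t, ⟨hw0, ?_, ?_, fun x => (hw x).continuousOn⟩, hw⟩
  · intro s t hs ht x
    exact IsTrajectoryOn.eqOn hf (((hw x).shift ht).mono Set.Icc_subset_Ici_self)
      ((hw (w x t)).mono Set.Icc_subset_Ici_self) (by simp [hw0]) ⟨hs, le_rfl⟩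
  · intro T hT
    rw [continuous_iff_continuousAt]
    intro x
    -- All trajectories starting within distance `1` of `x` stay in one ball, so Grönwall's estimate
    -- applies to them with a single Lipschitz constant.
    set Y := max ((‖x‖ + 1) ^ 2) (c / σ) with hY
    obtain ⟨K, hK⟩ := hf (Real.sqrt Y)
    have hmem : ∀ z, ‖z‖ ≤ ‖x‖ + 1 → ∀ t ∈ Set.Icc 0 T,
        w z t ∈ Metric.closedBall (0 : H) (Real.sqrt Y) := by
      intro z hz t ht
      rw [mem_closedBall_zero_iff]
      refine Real.le_sqrt_of_sq_le (((hw z).mono Set.Icc_subset_Ici_self).norm_sq_le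
        (inner_nonpos_of_dissipative hσ hdiss (le_max_right _ _)) ?_ t ht)
      rw [hw0]
      exact le_trans (by gcongr) (le_max_left _ _)
    have hdist : ∀ z, ‖z‖ ≤ ‖x‖ + 1 → dist (w z T) (w x T) ≤ dist z x * Real.exp (K * (T - 0)) := by
      intro z hz
      refine dist_le_of_trajectories_ODE_of_mem (v := fun _ => f)
        (s := fun _ => Metric.closedBall 0 (Real.sqrt Y)) (fun _ _ => hK)
        ((hw z).mono Set.Icc_subset_Ici_self).continuousOn
        (fun t ht => ((hw z).mono Set.Icc_subset_Ici_self).hasDerivWithinAt_right ht)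
        (fun t ht => hmem z hz t ⟨ht.1, ht.2.le⟩)
        ((hw x).mono Set.Icc_subset_Ici_self).continuousOn
        (fun t ht => ((hw x).mono Set.Icc_subset_Ici_self).hasDerivWithinAt_right ht)
        (fun t ht => hmem x (by linarith) t ⟨ht.1, ht.2.le⟩) ?_ T ⟨hT, le_rfl⟩
      rw [hw0, hw0]
    have hev : ∀ᶠ z in 𝓝 x, ‖z‖ ≤ ‖x‖ + 1 := by
      have : ∀ᶠ z in 𝓝 x, ‖z‖ < ‖x‖ + 1 :=
        continuous_norm.continuousAt.eventually_lt continuousAt_const (by linarith)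
      exact this.mono fun z hz => hz.le
    rw [ContinuousAt, tendsto_iff_dist_tendsto_zero]
    refine squeeze_zero' (Eventually.of_forall fun _ => dist_nonneg)
      (hev.mono fun z hz => hdist z hz) ?_
    have : Tendsto (fun z => dist z x * Real.exp (K * (T - 0))) (𝓝 x)
        (𝓝 (dist x x * Real.exp (K * (T - 0)))) := Continuous.tendsto (by fun_prop) x
    simpa using this

end AbstractODE

/-! ### Attractors of asymptotically compact semigroups -/

section Attractors

variable {X : Type*} [MetricSpace X] {S : ℝ → X → X}

/-- From some time on, the image of a bounded set is arbitrarily close to a compact set. -/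
def IsAsymptoticallyCompact (S : ℝ → X → X) : Prop :=
  ∀ B : Set X, Bornology.IsBounded B → ∀ r : ℝ, 0 < r →
    ∃ T : ℝ, ∃ C : Set X, IsCompact C ∧ ∀ t : ℝ, T ≤ t → S t '' B ⊆ Metric.thickening r C

/-- The range of the sequence is totally bounded: late terms are near a finite net of a compact set,
and the finitely many early terms join the net. -/
theorem IsAsymptoticallyCompact.exists_tendsto_subseq [CompleteSpace X]
    (hAC : IsAsymptoticallyCompact S) {B : Set X} (hB : Bornology.IsBounded B) {t : ℕ → ℝ}
    {x : ℕ → X} (ht : Tendsto t atTop atTop) (hx : ∀ k, x k ∈ B) :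
    ∃ y : X, ∃ φ : ℕ → ℕ, StrictMono φ ∧
      Tendsto (fun k => S (t (φ k)) (x (φ k))) atTop (𝓝 y) := by
  set s : ℕ → X := fun k => S (t k) (x k) with hs
  have htb : TotallyBounded (Set.range s) := by
    rw [Metric.totallyBounded_iff]
    intro r hr
    obtain ⟨T, C, hC, hT⟩ := hAC B hB (r / 2) (by positivity)
    obtain ⟨F, hF, hCF⟩ := Metric.totallyBounded_iff.1 hC.totallyBounded (r / 2) (by positivity)
    obtain ⟨k₀, hk₀⟩ := eventually_atTop.1 (ht.eventually_ge_atTop T)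
    refine ⟨F ∪ s '' Set.Iio k₀, hF.union ((Set.finite_Iio k₀).image s), ?_⟩
    rintro _ ⟨k, rfl⟩
    rcases lt_or_ge k k₀ with hk | hk
    · exact Set.mem_biUnion (Or.inr ⟨k, hk, rfl⟩) (Metric.mem_ball_self hr)
    · obtain ⟨z, hz, hzk⟩ := Metric.mem_thickening_iff.1 (hT (t k) (hk₀ k hk) ⟨x k, hx k, rfl⟩)
      obtain ⟨w, hw, hzw⟩ := Set.mem_iUnion₂.1 (hCF hz)
      refine Set.mem_biUnion (Or.inl hw) ?_
      rw [Metric.mem_ball] at hzw ⊢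
      linarith [dist_triangle (s k) z w]
  have hcomp : IsCompact (closure (Set.range s)) :=
    isCompact_iff_totallyBounded_isComplete.2 ⟨htb.closure, isClosed_closure.isComplete⟩
  obtain ⟨y, -, φ, hφ, hy⟩ := hcomp.tendsto_subseq (x := s)
    fun k => subset_closure (Set.mem_range_self k)
  exact ⟨y, φ, hφ, hy⟩

theorem exists_seq_of_mem_omegaLimit {B : Set X} {y : X} (hy : y ∈ omegaLimit atTop S B) (k : ℕ) :
    ∃ t : ℝ, (k : ℝ) ≤ t ∧ ∃ x ∈ B, dist (S t x) y < 1 / ((k : ℝ) + 1) := by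
  rw [mem_omegaLimit_iff_frequently] at hy
  obtain ⟨t, ht, x, hx, hxt⟩ :=
    frequently_atTop.1 (hy _ (Metric.ball_mem_nhds y (ε := 1 / ((k : ℝ) + 1)) (by positivity))) k
  exact ⟨t, ht, x, hx, hxt⟩

theorem tendsto_atTop_of_natCast_le {t : ℕ → ℝ} (h : ∀ k : ℕ, (k : ℝ) ≤ t k) :
    Tendsto t atTop atTop :=
  tendsto_atTop_mono h tendsto_natCast_atTop_atTop

theorem mem_omegaLimit_iff_seq {B : Set X} {y : X} :
    y ∈ omegaLimit atTop S B ↔ ∃ t : ℕ → ℝ, ∃ x : ℕ → X, Tendsto t atTop atTop ∧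
      (∀ k, x k ∈ B) ∧ Tendsto (fun k => S (t k) (x k)) atTop (𝓝 y) := by
  constructor
  · intro hy
    choose t ht x hx hd using exists_seq_of_mem_omegaLimit hy
    refine ⟨t, x, tendsto_atTop_of_natCast_le ht, hx, ?_⟩
    rw [tendsto_iff_dist_tendsto_zero]
    exact squeeze_zero (fun _ => dist_nonneg) (fun k => (hd k).le)
      tendsto_one_div_add_atTop_nhds_zero_nat
  · rintro ⟨t, x, ht, hx, hy⟩
    rw [mem_omegaLimit_iff_frequently]
    intro n hn
    refine ht.frequently (Eventually.frequently ?_)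
    filter_upwards [hy hn] with k hk
    exact ⟨x k, hx k, hk⟩

theorem IsFunctionalInvariant.subset_of_isBoundedAbsorbing {Y B : Set X}
    (hY : IsFunctionalInvariant S Y) (hYb : Bornology.IsBounded Y) (hB : IsBoundedAbsorbing S B) :
    Y ⊆ B := by
  obtain ⟨t, ht, h⟩ := hB.2 Y hYb
  exact (hY t ht).symm.subset.trans (h t le_rfl)

namespace IsAsymptoticallyCompact

variable [CompleteSpace X] {B : Set X}

/-- Each `y k` is approximated within `1 / (k + 1)` by a point of an orbit from `B` at a time `≥ k`;
a convergent subsequence of these points carries the `y k` along. -/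
theorem isCompact_omegaLimit (hAC : IsAsymptoticallyCompact S) (hB : Bornology.IsBounded B) :
    IsCompact (omegaLimit atTop S B) := by
  refine IsSeqCompact.isCompact fun y hy => ?_
  choose t ht x hx hd using fun k => exists_seq_of_mem_omegaLimit (hy k) k
  obtain ⟨z, φ, hφ, hz⟩ := hAC.exists_tendsto_subseq hB (tendsto_atTop_of_natCast_le ht) hx
  refine ⟨z, mem_omegaLimit_iff_seq.2 ⟨t ∘ φ, x ∘ φ,
    (tendsto_atTop_of_natCast_le ht).comp hφ.tendsto_atTop, fun k => hx _, hz⟩, φ, hφ, ?_⟩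
  refine tendsto_of_tendsto_of_dist hz ?_
  exact squeeze_zero (fun _ => dist_nonneg) (fun k => (hd (φ k)).le)
    (tendsto_one_div_add_atTop_nhds_zero_nat.comp hφ.tendsto_atTop)

theorem nonempty_omegaLimit (hAC : IsAsymptoticallyCompact S) (hB : Bornology.IsBounded B)
    (hne : B.Nonempty) : (omegaLimit atTop S B).Nonempty := by
  obtain ⟨x, hx⟩ := hne
  obtain ⟨z, φ, hφ, hz⟩ := hAC.exists_tendsto_subseq hB (t := fun k => (k : ℝ)) (x := fun _ => x)
    tendsto_natCast_atTop_atTop fun _ => hx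
  exact ⟨z, mem_omegaLimit_iff_seq.2 ⟨_, fun _ => x,
    tendsto_natCast_atTop_atTop.comp hφ.tendsto_atTop, fun _ => hx, hz⟩⟩

theorem eventually_image_subset_thickening (hAC : IsAsymptoticallyCompact S)
    (hB : Bornology.IsBounded B) {r : ℝ} (hr : 0 < r) :
    ∃ t₀ : ℝ, 0 ≤ t₀ ∧ ∀ t : ℝ, t₀ ≤ t →
      S t '' B ⊆ Metric.thickening r (omegaLimit atTop S B) := by
  by_contra! hcon
  have : ∀ k : ℕ, ∃ t : ℝ, (k : ℝ) ≤ t ∧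
      ∃ x ∈ B, S t x ∉ Metric.thickening r (omegaLimit atTop S B) := by
    intro k
    obtain ⟨t, ht, h⟩ := hcon k k.cast_nonneg
    obtain ⟨_, ⟨x, hx, rfl⟩, hxt⟩ := Set.not_subset.1 h
    exact ⟨t, ht, x, hx, hxt⟩
  choose t ht x hx hn using this
  obtain ⟨z, φ, hφ, hz⟩ := hAC.exists_tendsto_subseq hB (tendsto_atTop_of_natCast_le ht) hx
  have hzA : z ∈ omegaLimit atTop S B := mem_omegaLimit_iff_seq.2 ⟨t ∘ φ, x ∘ φ,
    (tendsto_atTop_of_natCast_le ht).comp hφ.tendsto_atTop, fun k => hx _, hz⟩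
  obtain ⟨k, hk⟩ := (hz.eventually (Metric.ball_mem_nhds z hr)).exists
  exact hn (φ k) (Metric.mem_thickening_iff.2 ⟨z, hzA, hk⟩)

/-- Continuity of `S s` gives forward invariance. For a preimage of `y = lim S (t k) (x k)`, a limit
point of `S (t k - s) (x k)` exists by asymptotic compactness, and `S s` maps it to `y`. -/
theorem isFunctionalInvariant_omegaLimit (hAC : IsAsymptoticallyCompact S)
    (hS : IsContinuousSemigroup S) (hB : Bornology.IsBounded B) :
    IsFunctionalInvariant S (omegaLimit atTop S B) := by
  intro s hs
  apply Set.Subset.antisymm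
  · rintro _ ⟨y, hy, rfl⟩
    obtain ⟨t, x, ht, hx, hlim⟩ := mem_omegaLimit_iff_seq.1 hy
    refine mem_omegaLimit_iff_seq.2 ⟨fun k => s + t k, x,
      tendsto_atTop_add_const_left _ s ht, hx, ?_⟩
    refine (((hS.continuous_map s hs).tendsto y).comp hlim).congr' ?_
    filter_upwards [ht.eventually_ge_atTop 0] with k hk
    exact (hS.add s (t k) hs hk (x k)).symm
  · intro y hy
    obtain ⟨t, x, ht, hx, hlim⟩ := mem_omegaLimit_iff_seq.1 hy
    have ht' : Tendsto (fun k => t k - s) atTop atTop := tendsto_atTop_add_const_right _ (-s) ht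
    obtain ⟨z, φ, hφ, hz⟩ := hAC.exists_tendsto_subseq hB ht' hx
    refine ⟨z, mem_omegaLimit_iff_seq.2 ⟨_, x ∘ φ, ht'.comp hφ.tendsto_atTop,
      fun k => hx _, hz⟩, ?_⟩
    refine tendsto_nhds_unique (((hS.continuous_map s hs).tendsto z).comp hz) ?_
    refine (hlim.comp hφ.tendsto_atTop).congr' ?_
    filter_upwards [(ht'.comp hφ.tendsto_atTop).eventually_ge_atTop 0] with k hk
    have := hS.add s (t (φ k) - s) hs hk (x (φ k))
    rw [add_sub_cancel] at this
    exact this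

theorem isGlobalAttractor_omegaLimit (hAC : IsAsymptoticallyCompact S)
    (hS : IsContinuousSemigroup S) (hB : IsBoundedAbsorbing S B) :
    IsGlobalAttractor S (omegaLimit atTop S B) where
  compact := hAC.isCompact_omegaLimit hB.1
  invariant := hAC.isFunctionalInvariant_omegaLimit hS hB.1
  attracts := by
    intro B' hB' r hr
    obtain ⟨t₁, ht₁, h₁⟩ := hB.2 B' hB'
    obtain ⟨t₂, ht₂, h₂⟩ := hAC.eventually_image_subset_thickening hB.1 hr
    -- Time `t₁` brings `B'` into `B`, and a further time at least `t₂` brings `B` near its ω-limit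
    -- set.
    refine ⟨t₂ + t₁, add_nonneg ht₂ ht₁, ?_⟩
    rintro t ht _ ⟨x, hx, rfl⟩
    have h3 := hS.add (t - t₁) t₁ (by linarith) ht₁ x
    rw [sub_add_cancel] at h3
    rw [h3]
    exact h₂ _ (by linarith) ⟨_, h₁ t₁ le_rfl ⟨x, hx, rfl⟩, rfl⟩

end IsAsymptoticallyCompact

/-- A bounded invariant `Y = S t Y` lies in every thickening of `A`, and `A` is closed. -/
theorem IsGlobalAttractor.subset_of_isBounded {A Y : Set X} (hA : IsGlobalAttractor S A)
    (hY : IsFunctionalInvariant S Y) (hYb : Bornology.IsBounded Y) : Y ⊆ A := by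
  intro y hy
  rw [← hA.compact.isClosed.closure_eq, Metric.mem_closure_iff]
  intro r hr
  obtain ⟨t, ht, h⟩ := hA.attracts Y hYb r hr
  rw [← hY t ht] at hy
  exact Metric.mem_thickening_iff.1 (h t le_rfl hy)

/-- If `A` split into two separated pieces, they would have disjoint thickenings. For large `t` the
connected set `S t B` is covered by these, yet it contains `A` and so meets both. -/
theorem IsGlobalAttractor.isPreconnected {A B : Set X} (hA : IsGlobalAttractor S A)
    (hS : IsContinuousSemigroup S) (hB : IsBoundedAbsorbing S B) (hBc : IsPreconnected B) :
    IsPreconnected A := by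
  rw [isPreconnected_iff_subset_of_disjoint_closed]
  intro U V hU hV hUV hdisj
  by_contra! hcon
  have hdisj' : Disjoint (A ∩ U) (A ∩ V) := by
    rw [Set.disjoint_iff_inter_eq_empty, ← hdisj]
    ext z
    simp only [Set.mem_inter_iff]
    tauto
  obtain ⟨r, hr, hthick⟩ := hdisj'.exists_thickenings (hA.compact.inter_right hU)
    (hA.compact.inter_right hV).isClosed
  obtain ⟨t, ht, h⟩ := hA.attracts B hB.1 r hr
  have hAB : A ⊆ S t '' B := by
    rw [← hA.invariant t ht]
    exact Set.image_mono (hA.invariant.subset_of_isBoundedAbsorbing hA.compact.isBounded hB)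
  have hconn : IsPreconnected (S t '' B) := hBc.image _ (hS.continuous_map t ht).continuousOn
  have hcover : S t '' B ⊆ Metric.thickening r (A ∩ U) ∪ Metric.thickening r (A ∩ V) := by
    rw [← Metric.thickening_union, ← Set.inter_union_distrib_left,
      Set.inter_eq_self_of_subset_left hUV]
    exact h t le_rfl
  have hpoint : ∀ W W' : Set X, A ⊆ W ∪ W' → ¬ A ⊆ W' →
      (S t '' B ∩ Metric.thickening r (A ∩ W)).Nonempty := by
    intro W W' hWW hW'
    obtain ⟨z, hz, hzW'⟩ := Set.not_subset.1 hW'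
    exact ⟨z, hAB hz, Metric.self_subset_thickening hr _ ⟨hz, (hWW hz).resolve_right hzW'⟩⟩
  obtain ⟨z, -, hz1, hz2⟩ := hconn _ _ Metric.isOpen_thickening Metric.isOpen_thickening hcover
    (hpoint U V hUV hcon.2) (hpoint V U (by rwa [Set.union_comm]) hcon.1)
  exact Set.disjoint_left.1 hthick hz1 hz2

end Attractors

/-- Bernoulli's inequality at `x / y`: a convex power lies above its tangent. It serves both the
Lipschitz bound for `F` and Jensen's inequality. -/
theorem Real.add_mul_sub_le_rpow {x y q : ℝ} (hx : 0 ≤ x) (hy : 0 < y) (hq : 1 ≤ q) :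
    y ^ q + q * y ^ (q - 1) * (x - y) ≤ x ^ q := by
  have h := one_add_mul_self_le_rpow_one_add (s := x / y - 1)
    (by have : 0 ≤ x / y := by positivity
        linarith) hq
  rw [add_sub_cancel, Real.div_rpow hx hy.le, le_div_iff₀ (Real.rpow_pos_of_pos hy q)] at h
  refine le_trans (le_of_eq ?_) h
  rw [Real.rpow_sub_one hy.ne']
  field_simp

/-! ### The weighted space: coordinates, operators, completeness -/

namespace WeightedEll2

variable {θ : LatticeWeight}

instance : InnerProductSpace ℝ (WeightedEll2 θ) := InnerProductSpace.complexToReal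

theorem sub_apply (u v : WeightedEll2 θ) (n : ℤ) : (u - v) n = u n - v n := rfl

theorem hasSum_norm_sq (u : WeightedEll2 θ) : HasSum (fun n => θ n * ‖u n‖ ^ 2) (‖u‖ ^ 2) := by
  rw [norm_sq_eq]
  exact u.summable_sq.hasSum

theorem hasSum_real_inner (u v : WeightedEll2 θ) :
    HasSum (fun n => θ n * (starRingEnd ℂ (u n) * v n).re) (inner ℝ u v) := by
  have h : HasSum (fun n => (θ n : ℂ) * (starRingEnd ℂ (u n) * v n)) (inner ℂ u v) :=
    (summable_inner u v).hasSum
  have h2 := Complex.hasSum_re h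
  simp only [Complex.re_ofReal_mul] at h2
  exact h2

theorem mul_norm_sq_le (u : WeightedEll2 θ) (n : ℤ) : θ n * ‖u n‖ ^ 2 ≤ ‖u‖ ^ 2 :=
  le_hasSum u.hasSum_norm_sq n fun m _ => mul_nonneg (θ.pos m).le (sq_nonneg _)

theorem norm_apply_le (u : WeightedEll2 θ) (n : ℤ) : ‖u n‖ ≤ ‖u‖ := by
  refine pow_le_pow_iff_left₀ (norm_nonneg _) (norm_nonneg _) two_ne_zero |>.1 ?_
  refine le_trans ?_ (u.mul_norm_sq_le n)
  exact le_mul_of_one_le_left (sq_nonneg _) (θ.one_le n)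

theorem norm_le_of_forall_le {u v : WeightedEll2 θ} {K : ℝ} (hK : 0 ≤ K)
    (h : ∀ n, ‖v n‖ ≤ K * ‖u n‖) : ‖v‖ ≤ K * ‖u‖ := by
  refine pow_le_pow_iff_left₀ (norm_nonneg _) (by positivity) two_ne_zero |>.1 ?_
  rw [mul_pow]
  refine hasSum_le (fun n => ?_) v.hasSum_norm_sq (u.hasSum_norm_sq.mul_left (K ^ 2))
  have := (θ.pos n).le
  calc θ n * ‖v n‖ ^ 2 ≤ θ n * (K * ‖u n‖) ^ 2 := by gcongr; exact h n
    _ = _ := by ring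

/-- The element of `ℓ²_θ` given by a sequence which is dominated by an element of `ℓ²_θ`. -/
def ofDominated (x : ℤ → ℂ) (u : WeightedEll2 θ) (K : ℝ) (h : ∀ n, ‖x n‖ ≤ K * ‖u n‖) :
    WeightedEll2 θ :=
  ⟨x, Summable.of_nonneg_of_le (fun n => mul_nonneg (θ.pos n).le (sq_nonneg _))
    (fun n => by
      have := (θ.pos n).le
      calc θ n * ‖x n‖ ^ 2 ≤ θ n * (K * ‖u n‖) ^ 2 := by gcongr; exact h n
        _ = K ^ 2 * (θ n * ‖u n‖ ^ 2) := by ring)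
    (u.summable_sq.mul_left (K ^ 2))⟩

/-- Multiplication by a real sequence with values in `[-1, 1]`. -/
def mulOp (m : ℤ → ℝ) (hm : ∀ n, |m n| ≤ 1) : WeightedEll2 θ →L[ℝ] WeightedEll2 θ :=
  LinearMap.mkContinuous
    { toFun := fun u => ofDominated (fun n => (m n : ℂ) * u n) u 1 fun n => by
        rw [norm_mul, Complex.norm_real, Real.norm_eq_abs]
        exact mul_le_mul_of_nonneg_right (hm n) (norm_nonneg _)
      map_add' := fun u v => ext fun n => mul_add _ _ _
      map_smul' := fun c u => ext fun n => mul_left_comm _ _ _ } 1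
    fun u => norm_le_of_forall_le zero_le_one fun n => by
      change ‖(m n : ℂ) * u n‖ ≤ _
      rw [norm_mul, Complex.norm_real, Real.norm_eq_abs]
      exact mul_le_mul_of_nonneg_right (hm n) (norm_nonneg _)

theorem mulOp_apply (m : ℤ → ℝ) (hm : ∀ n, |m n| ≤ 1) (u : WeightedEll2 θ) (n : ℤ) :
    mulOp m hm u n = (m n : ℂ) * u n := rfl

theorem summable_shift {s : ℤ} {C : ℝ} (h : ∀ n, θ n ≤ C * θ (n + s)) (u : WeightedEll2 θ) :
    Summable fun n => θ n * ‖u (n + s)‖ ^ 2 := by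
  have h1 : Summable fun n => θ (n + s) * ‖u (n + s)‖ ^ 2 :=
    (Equiv.addRight s).summable_iff.2 u.summable_sq
  refine Summable.of_nonneg_of_le (fun n => mul_nonneg (θ.pos n).le (sq_nonneg _)) (fun n => ?_)
    (h1.mul_left C)
  rw [← mul_assoc]
  exact mul_le_mul_of_nonneg_right (h n) (sq_nonneg _)

/-- The translation `u ↦ (u (n + s))ₙ`. -/
def shiftOp (s : ℤ) (C : ℝ) (h : ∀ n, θ n ≤ C * θ (n + s)) :
    WeightedEll2 θ →L[ℂ] WeightedEll2 θ :=
  LinearMap.mkContinuous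
    { toFun := fun u => ⟨fun n => u (n + s), summable_shift h u⟩
      map_add' := fun u v => ext fun n => rfl
      map_smul' := fun c u => ext fun n => rfl } (Real.sqrt C)
    fun u => by
      have hC : 0 ≤ C := by
        have h0 := (θ.pos 0).trans_le (h 0)
        exact (pos_of_mul_pos_left h0 (θ.pos _).le).le
      refine pow_le_pow_iff_left₀ (norm_nonneg _) (by positivity) two_ne_zero |>.1 ?_
      rw [mul_pow, Real.sq_sqrt hC]
      refine hasSum_le (fun n => ?_) (hasSum_norm_sq _)
        (((Equiv.addRight s).hasSum_iff.2 u.hasSum_norm_sq).mul_left C)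
      change θ n * ‖u (n + s)‖ ^ 2 ≤ C * (θ (n + s) * ‖u (n + s)‖ ^ 2)
      rw [← mul_assoc]
      exact mul_le_mul_of_nonneg_right (h n) (sq_nonneg _)

theorem norm_sqrt_mul_sq (θ : LatticeWeight) (x : ℤ → ℂ) (n : ℤ) :
    ‖((Real.sqrt (θ n) : ℝ) : ℂ) * x n‖ ^ 2 = θ n * ‖x n‖ ^ 2 := by
  rw [norm_mul, mul_pow, Complex.norm_real, Real.norm_of_nonneg (Real.sqrt_nonneg _),
    Real.sq_sqrt (θ.pos n).le]

/-- The isometry `u ↦ (√(θ n) u n)ₙ` of `ℓ²_θ` onto `ℓ²`. -/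
def toLp : WeightedEll2 θ →ₗ[ℂ] lp (fun _ : ℤ => ℂ) 2 where
  toFun u := ⟨fun n => ((Real.sqrt (θ n) : ℝ) : ℂ) * u n, by
    refine (memℓp_gen_iff (by norm_num)).2 ?_
    simp only [ENNReal.toReal_ofNat, Real.rpow_ofNat, norm_sqrt_mul_sq]
    exact u.summable_sq⟩
  map_add' u v := by
    ext n
    exact mul_add _ _ _
  map_smul' c u := by
    ext n
    exact mul_left_comm _ _ _

theorem norm_toLp (u : WeightedEll2 θ) : ‖toLp u‖ = ‖u‖ := by
  refine (pow_left_inj₀ (norm_nonneg _) (norm_nonneg _) two_ne_zero).1 ?_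
  have h := lp.norm_rpow_eq_tsum (p := 2) (by norm_num) (toLp u)
  simp only [ENNReal.toReal_ofNat, Real.rpow_ofNat] at h
  rw [h, norm_sq_eq]
  exact tsum_congr fun n => norm_sqrt_mul_sq θ u n

theorem toLp_surjective : Function.Surjective (toLp (θ := θ)) := by
  intro x
  have hθ : ∀ n, ((Real.sqrt (θ n) : ℝ) : ℂ) ≠ 0 := fun n =>
    Complex.ofReal_ne_zero.2 (Real.sqrt_pos.2 (θ.pos n)).ne'
  have hmul : ∀ n, ((Real.sqrt (θ n) : ℝ) : ℂ) * (((Real.sqrt (θ n) : ℝ) : ℂ)⁻¹ * x n) = x n :=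
    fun n => mul_inv_cancel_left₀ (hθ n) _
  refine ⟨⟨fun n => ((Real.sqrt (θ n) : ℝ) : ℂ)⁻¹ * x n, ?_⟩, ?_⟩
  · have h := (memℓp_gen_iff (by norm_num)).1 (lp.memℓp x)
    simp only [ENNReal.toReal_ofNat, Real.rpow_ofNat] at h
    refine h.congr fun n => Eq.trans ?_ (norm_sqrt_mul_sq θ
      (fun n => ((Real.sqrt (θ n) : ℝ) : ℂ)⁻¹ * x n) n)
    exact congrArg (fun z : ℂ => ‖z‖ ^ 2) (hmul n).symm
  · ext n
    exact hmul n

instance : CompleteSpace (WeightedEll2 θ) := by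
  have hiso : Isometry (toLp (θ := θ)) := AddMonoidHomClass.isometry_of_norm _ norm_toLp
  exact (hiso.isUniformInducing.completeSpace_congr toLp_surjective).2 inferInstance

end WeightedEll2

/-! ### Local Lipschitz continuity of the nonlinearity -/

namespace LatticeParams

variable (P : LatticeParams)

theorem norm_F (s : ℂ) : ‖P.F s‖ = ‖s‖ ^ (P.p - 1) * ‖s‖ := by
  rw [F, norm_mul, Complex.norm_real, Real.norm_of_nonneg (Real.rpow_nonneg (norm_nonneg _) _)]

/-- Since `s ^ (p - 1)` need not be Lipschitz at `0` when `p < 2`, the difference of these powers is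
kept multiplied by the smaller `b`; the tangent of `s ^ p` at `‖a‖` then bounds the product. -/
theorem norm_F_sub_le_of_le (hp : 1 < P.p) {a b : ℂ} {R : ℝ} (ha : ‖a‖ ≤ R) (hba : ‖b‖ ≤ ‖a‖) :
    ‖P.F a - P.F b‖ ≤ (1 + P.p) * R ^ (P.p - 1) * ‖a - b‖ := by
  rcases (norm_nonneg a).eq_or_lt with h0 | h0
  · have hb : b = 0 := norm_le_zero_iff.1 (hba.trans h0.symm.le)
    have ha : a = 0 := norm_eq_zero.1 h0.symm
    simp [ha, hb]
  have hR : ‖a‖ ^ (P.p - 1) ≤ R ^ (P.p - 1) := Real.rpow_le_rpow h0.le ha (by linarith)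
  have hR0 : 0 ≤ R ^ (P.p - 1) := (Real.rpow_nonneg h0.le _).trans hR
  have e : P.F a - P.F b = ((‖a‖ ^ (P.p - 1) : ℝ) : ℂ) * (a - b)
      + ((‖a‖ ^ (P.p - 1) - ‖b‖ ^ (P.p - 1) : ℝ) : ℂ) * b := by
    simp only [F]
    push_cast
    ring
  have hmono : ‖b‖ ^ (P.p - 1) ≤ ‖a‖ ^ (P.p - 1) :=
    Real.rpow_le_rpow (norm_nonneg b) hba (by linarith)
  have h1 : ‖((‖a‖ ^ (P.p - 1) : ℝ) : ℂ) * (a - b)‖ ≤ R ^ (P.p - 1) * ‖a - b‖ := by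
    rw [norm_mul, Complex.norm_real, Real.norm_of_nonneg (Real.rpow_nonneg h0.le _)]
    gcongr
  have h2 : ‖((‖a‖ ^ (P.p - 1) - ‖b‖ ^ (P.p - 1) : ℝ) : ℂ) * b‖
      ≤ P.p * R ^ (P.p - 1) * ‖a - b‖ := by
    rw [norm_mul, Complex.norm_real, Real.norm_of_nonneg (by linarith)]
    have hsub : ∀ x : ℝ, 0 ≤ x → x ^ (P.p - 1) * x = x ^ P.p := by
      intro x hx
      rw [← Real.rpow_add_one' hx (by linarith), sub_add_cancel]
    have ht := Real.add_mul_sub_le_rpow (norm_nonneg b) h0 hp.le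
    have hle : ‖a‖ ^ (P.p - 1) * ‖b‖ ≤ ‖a‖ ^ P.p := by
      rw [← hsub _ h0.le]
      gcongr
    have hd : ‖a‖ - ‖b‖ ≤ ‖a - b‖ := norm_sub_norm_le a b
    calc (‖a‖ ^ (P.p - 1) - ‖b‖ ^ (P.p - 1)) * ‖b‖
        = ‖a‖ ^ (P.p - 1) * ‖b‖ - ‖b‖ ^ P.p := by rw [sub_mul, hsub _ (norm_nonneg b)]
      _ ≤ P.p * ‖a‖ ^ (P.p - 1) * (‖a‖ - ‖b‖) := by linarith
      _ ≤ P.p * R ^ (P.p - 1) * ‖a - b‖ := by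
        have : 0 ≤ P.p := by linarith
        gcongr
  rw [e]
  refine (norm_add_le _ _).trans ?_
  linarith

theorem norm_F_sub_le (hp : 1 < P.p) {a b : ℂ} {R : ℝ} (ha : ‖a‖ ≤ R) (hb : ‖b‖ ≤ R) :
    ‖P.F a - P.F b‖ ≤ (1 + P.p) * R ^ (P.p - 1) * ‖a - b‖ := by
  rcases le_total ‖b‖ ‖a‖ with h | h
  · exact P.norm_F_sub_le_of_le hp ha h
  · rw [norm_sub_rev, norm_sub_rev a]
    exact P.norm_F_sub_le_of_le hp hb h

variable {θ : LatticeWeight}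

/-- The superposition operator of `F` on `ℓ²_θ`. -/
def superposition (hp : 1 < P.p) (u : WeightedEll2 θ) : WeightedEll2 θ :=
  WeightedEll2.ofDominated (fun n => P.F (u n)) u (‖u‖ ^ (P.p - 1)) fun n => by
    rw [P.norm_F]
    have : 0 ≤ P.p - 1 := by linarith
    gcongr
    exact u.norm_apply_le n

theorem norm_superposition_sub_le (hp : 1 < P.p) {u v : WeightedEll2 θ} {R : ℝ} (hu : ‖u‖ ≤ R)
    (hv : ‖v‖ ≤ R) :
    ‖P.superposition hp u - P.superposition hp v‖ ≤ (1 + P.p) * R ^ (P.p - 1) * ‖u - v‖ := by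
  have hR : 0 ≤ R := (norm_nonneg u).trans hu
  refine WeightedEll2.norm_le_of_forall_le
    (mul_nonneg (by linarith) (Real.rpow_nonneg hR _)) fun n => ?_
  exact P.norm_F_sub_le hp ((u.norm_apply_le n).trans hu) ((v.norm_apply_le n).trans hv)

end LatticeParams

/-! ### The lattice equation as a differential equation in the weighted space -/

namespace LatticeWeight.WS

variable {θ : LatticeWeight} {D dlow dup : ℝ}

theorem le_mul_succ (hθ : θ.WS D dlow dup) (n : ℤ) : θ n ≤ dlow⁻¹ * θ (n + 1) := by
  rw [inv_mul_eq_div, le_div_iff₀ hθ.dlow_pos, mul_comm]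
  exact hθ.low_le n

theorem le_mul_pred (hθ : θ.WS D dlow dup) (n : ℤ) : θ n ≤ dup * θ (n + -1) := by
  have := hθ.le_up (n + -1)
  rwa [neg_add_cancel_right] at this

end LatticeWeight.WS

namespace LatticeParams

variable (P : LatticeParams) {θ : LatticeWeight} {D dlow dup : ℝ}

/-- The linear part of the lattice equation, solved for the time derivative. -/
def linearPart (hθ : θ.WS D dlow dup) : WeightedEll2 θ →L[ℂ] WeightedEll2 θ :=
  (Complex.I * P.α - P.β) •
      (WeightedEll2.shiftOp (-1) dup hθ.le_mul_pred - (2 : ℂ) • ContinuousLinearMap.id ℂ _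
        + WeightedEll2.shiftOp 1 dlow⁻¹ hθ.le_mul_succ)
    + (Complex.I * P.γ - P.δ) • ContinuousLinearMap.id ℂ _

/-- The right hand side of the lattice equation, solved for the time derivative. -/
def field (hθ : θ.WS D dlow dup) (hp : 1 < P.p) (g u : WeightedEll2 θ) : WeightedEll2 θ :=
  P.linearPart hθ u + (Complex.I * P.η - P.ζ) • P.superposition hp u - Complex.I • g

theorem field_apply (hθ : θ.WS D dlow dup) (hp : 1 < P.p) (g u : WeightedEll2 θ) (n : ℤ) :
    P.field hθ hp g u n =
      (Complex.I * P.α - P.β) * (u (n - 1) - 2 * u n + u (n + 1))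
        + (Complex.I * P.γ - P.δ) * u n + (Complex.I * P.η - P.ζ) * P.F (u n)
        - Complex.I * g n := rfl

theorem eq_field_iff (hθ : θ.WS D dlow dup) (hp : 1 < P.p) (g u v : WeightedEll2 θ) :
    v = P.field hθ hp g u ↔ ∀ n : ℤ,
        Complex.I * v n + ((P.α : ℂ) + Complex.I * P.β) * (u (n - 1) - 2 * u n + u (n + 1))
          + ((P.γ : ℂ) + Complex.I * P.δ) * u n
          + ((P.η : ℂ) + Complex.I * P.ζ) * P.F (u n) = g n := by
  have hI : Complex.I * Complex.I = -1 := Complex.I_mul_I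
  constructor
  · rintro rfl n
    rw [field_apply]
    linear_combination (P.α * (u (n - 1) - 2 * u n + u (n + 1)) + P.γ * u n
      + P.η * P.F (u n) - g n) * hI
  · intro h
    refine WeightedEll2.ext fun n => ?_
    rw [field_apply]
    linear_combination (-Complex.I) * h n + (v n + P.β * (u (n - 1) - 2 * u n + u (n + 1))
      + P.δ * u n + P.ζ * P.F (u n)) * hI

theorem exists_lipschitzOnWith_field (hθ : θ.WS D dlow dup) (hp : 1 < P.p) (g : WeightedEll2 θ)
    (R : ℝ) : ∃ K : NNReal, LipschitzOnWith K (P.field hθ hp g) (Metric.closedBall 0 R) := by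
  set C : ℝ := ‖P.linearPart hθ‖
    + ‖Complex.I * P.η - P.ζ‖ * ((1 + P.p) * R ^ (P.p - 1)) with hC
  refine ⟨C.toNNReal, LipschitzOnWith.of_dist_le_mul fun u hu v hv => ?_⟩
  rw [mem_closedBall_zero_iff] at hu hv
  rw [dist_eq_norm, dist_eq_norm]
  have e : P.field hθ hp g u - P.field hθ hp g v = P.linearPart hθ (u - v)
      + (Complex.I * P.η - P.ζ) • (P.superposition hp u - P.superposition hp v) := by
    simp only [field, map_sub, smul_sub]
    abel
  have h1 : ‖P.field hθ hp g u - P.field hθ hp g v‖ ≤ C * ‖u - v‖ := by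
    rw [e, hC, add_mul, mul_assoc]
    refine (norm_add_le _ _).trans (add_le_add ((P.linearPart hθ).le_opNorm _) ?_)
    rw [norm_smul]
    exact mul_le_mul_of_nonneg_left (P.norm_superposition_sub_le hp hu hv) (norm_nonneg _)
  exact h1.trans (mul_le_mul_of_nonneg_right (Real.le_coe_toNNReal _) (norm_nonneg _))

theorem isSolutionOn_iff (hθ : θ.WS D dlow dup) (hp : 1 < P.p) (g u₀ : WeightedEll2 θ) (J : Set ℝ)
    (u : ℝ → WeightedEll2 θ) :
    P.IsSolutionOn g u₀ J u ↔ u 0 = u₀ ∧ IsTrajectoryOn (P.field hθ hp g) J u := by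
  constructor
  · rintro ⟨h0, du, -, h⟩
    refine ⟨h0, fun t ht => ?_⟩
    have := (h t ht).1
    rwa [(P.eq_field_iff hθ hp g (u t) (du t)).2 (h t ht).2] at this
  · rintro ⟨h0, h⟩
    refine ⟨h0, fun t => P.field hθ hp g (u t), ?_,
      fun t ht => ⟨h t ht, (P.eq_field_iff hθ hp g (u t) _).1 rfl⟩⟩
    -- Continuity of the derivative is automatic, because the field is continuous.
    have hc : Continuous (P.field hθ hp g) := by
      rw [continuous_iff_continuousAt]
      intro x
      obtain ⟨K, hK⟩ := P.exists_lipschitzOnWith_field hθ hp g (‖x‖ + 1)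
      refine hK.continuousOn.continuousAt ?_
      filter_upwards [continuous_norm.continuousAt.eventually_lt continuousAt_const
        (lt_add_one ‖x‖)] with z hz
      exact mem_closedBall_zero_iff.2 hz.le
    exact hc.comp_continuousOn h.continuousOn

end LatticeParams

/-! ### The energy inequality for slowly varying weights -/

/-- A positive weight on `ℤ` whose increments and quotients of neighbours are controlled. -/
structure IsSlowWeight (w : ℤ → ℝ) (D dlow dup : ℝ) : Prop where
  pos : ∀ n, 0 < w n
  D_nonneg : 0 ≤ D
  dlow_pos : 0 < dlow
  diff_le : ∀ n, |w (n + 1) - w n| ≤ D * w n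
  low_le : ∀ n, dlow * w n ≤ w (n + 1)
  le_up : ∀ n, w (n + 1) ≤ dup * w n

theorem LatticeWeight.WS.isSlowWeight {θ : LatticeWeight} {D dlow dup : ℝ}
    (hθ : θ.WS D dlow dup) : IsSlowWeight θ D dlow dup :=
  ⟨θ.pos, hθ.D_pos.le, hθ.dlow_pos, hθ.diff_le, hθ.low_le, hθ.le_up⟩

/-- Young's inequality with `w n` in one square replaced by `w (n + 1)` at the cost of `dlow⁻¹`;
this is the origin of `dlow ^ (-1/2)` in `sigma0`. Multiplying by `r` first avoids square roots of
the weight. -/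
theorem IsSlowWeight.mul_mul_le {w : ℤ → ℝ} {D dlow dup : ℝ} (hw : IsSlowWeight w D dlow dup)
    (n : ℤ) (s t : ℝ) :
    w n * (s * t) ≤ dlow ^ (-(1 / 2) : ℝ) * ((w n * s ^ 2 + w (n + 1) * t ^ 2) / 2) := by
  set r := dlow ^ (-(1 / 2) : ℝ) with hr
  have hr0 : 0 < r := Real.rpow_pos_of_pos hw.dlow_pos _
  have hr2 : r ^ 2 * dlow = 1 := by
    rw [hr, ← Real.rpow_natCast, ← Real.rpow_mul hw.dlow_pos.le]
    norm_num
    rw [Real.rpow_neg_one, inv_mul_cancel₀ hw.dlow_pos.ne']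
  have h1 : r ^ 2 * (dlow * w n) * t ^ 2 ≤ r ^ 2 * w (n + 1) * t ^ 2 := by
    gcongr
    exact hw.low_le n
  have h1' : w n * t ^ 2 ≤ r ^ 2 * (w (n + 1) * t ^ 2) := by
    calc w n * t ^ 2 = r ^ 2 * dlow * w n * t ^ 2 := by rw [hr2, one_mul]
      _ ≤ _ := by linarith
  have h2 : w n * (2 * (r * s) * t) ≤ w n * ((r * s) ^ 2 + t ^ 2) :=
    mul_le_mul_of_nonneg_left (two_mul_le_add_sq _ _) (hw.pos n).le
  have h3 : r * (w n * (s * t)) ≤ r * (r * ((w n * s ^ 2 + w (n + 1) * t ^ 2) / 2)) := by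
    linarith
  exact le_of_mul_le_mul_left h3 hr0

namespace LatticeParams

variable (P : LatticeParams)

/-- As `conj a * a` is real, `γ` and `η` drop out, and `α` leaves the difference of the currents `Im
(conj a * b)` and `Im (conj c * a)` across the two adjacent bonds. -/
theorem re_conj_mul_field_eq (a b c g : ℂ) (r : ℝ) :
    (starRingEnd ℂ a * ((Complex.I * P.α - P.β) * (c - 2 * a + b)
        + (Complex.I * P.γ - P.δ) * a + (Complex.I * P.η - P.ζ) * ((r : ℂ) * a)
        - Complex.I * g)).re
      = -P.α * ((starRingEnd ℂ a * b).im - (starRingEnd ℂ c * a).im)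
        - P.β * ((starRingEnd ℂ a * c).re + (starRingEnd ℂ a * b).re)
        + (2 * P.β - P.δ) * ‖a‖ ^ 2 - P.ζ * (r * ‖a‖ ^ 2) + (starRingEnd ℂ a * g).im := by
  rw [Complex.sq_norm, Complex.normSq_apply]
  simp
  ring

theorem abs_re_conj_mul_le (a b : ℂ) : |(starRingEnd ℂ a * b).re| ≤ ‖a‖ * ‖b‖ := by
  refine (Complex.abs_re_le_norm _).trans ?_
  rw [norm_mul, RCLike.norm_conj]

theorem abs_im_conj_mul_le (a b : ℂ) : |(starRingEnd ℂ a * b).im| ≤ ‖a‖ * ‖b‖ := by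
  refine (Complex.abs_im_le_norm _).trans ?_
  rw [norm_mul, RCLike.norm_conj]

theorem neg_mul_le_abs_mul (x y z : ℝ) (h : |y| ≤ z) : -(x * y) ≤ |x| * z := by
  refine (neg_le_abs _).trans ?_
  rw [abs_mul]
  exact mul_le_mul_of_nonneg_left h (abs_nonneg _)

/-- The pointwise form of the energy inequality; the `α` term is a telescoping difference up to a
controlled error. -/
theorem weight_mul_re_le {w : ℤ → ℝ} {D dlow dup ε : ℝ} (hw : IsSlowWeight w D dlow dup)
    (hε : 0 < ε) (u g : ℤ → ℂ) (n : ℤ) :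
    w n * (starRingEnd ℂ (u n) * ((Complex.I * P.α - P.β) * (u (n - 1) - 2 * u n + u (n + 1))
        + (Complex.I * P.γ - P.δ) * u n + (Complex.I * P.η - P.ζ) * P.F (u n)
        - Complex.I * g n)).re
      ≤ (-P.α * (w (n + 1) * (starRingEnd ℂ (u n) * u (n + 1)).im)
          + P.α * (w n * (starRingEnd ℂ (u (n - 1)) * u n).im))
        + |P.α| * D * dlow ^ (-(1 / 2) : ℝ)
            * ((w n * ‖u n‖ ^ 2 + w (n + 1) * ‖u (n + 1)‖ ^ 2) / 2)
        + |P.β| * (w n * ‖u n‖ ^ 2 + dup / 2 * (w (n - 1) * ‖u (n - 1)‖ ^ 2)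
            + dlow⁻¹ / 2 * (w (n + 1) * ‖u (n + 1)‖ ^ 2))
        + (2 * P.β - P.δ + ε / 2) * (w n * ‖u n‖ ^ 2)
        - P.ζ * (w n * (‖u n‖ ^ (P.p - 1) * ‖u n‖ ^ 2))
        + 1 / (2 * ε) * (w n * ‖g n‖ ^ 2) := by
  have hw0 := hw.pos n
  rw [F, re_conj_mul_field_eq]
  set a := u n
  set b := u (n + 1)
  set c := u (n - 1)
  -- Giving the outgoing current the weight `w (n + 1)` makes the currents telescope; this term is
  -- the error.
  have hα : -(P.α * ((w n - w (n + 1)) * (starRingEnd ℂ a * b).im))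
      ≤ |P.α| * D * dlow ^ (-(1 / 2) : ℝ) * ((w n * ‖a‖ ^ 2 + w (n + 1) * ‖b‖ ^ 2) / 2) := by
    have h1 : |(w n - w (n + 1)) * (starRingEnd ℂ a * b).im| ≤ D * w n * (‖a‖ * ‖b‖) := by
      rw [abs_mul, abs_sub_comm]
      exact mul_le_mul (hw.diff_le n) (abs_im_conj_mul_le a b) (abs_nonneg _)
        (mul_nonneg hw.D_nonneg hw0.le)
    refine (neg_mul_le_abs_mul _ _ _ h1).trans ?_
    have h2 := mul_le_mul_of_nonneg_left
      (hw.mul_mul_le n ‖a‖ ‖b‖) hw.D_nonneg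
    have h3 := mul_le_mul_of_nonneg_left h2 (abs_nonneg P.α)
    linarith
  have hβ : -(P.β * (w n * ((starRingEnd ℂ a * c).re + (starRingEnd ℂ a * b).re)))
      ≤ |P.β| * (w n * ‖a‖ ^ 2 + dup / 2 * (w (n - 1) * ‖c‖ ^ 2)
            + dlow⁻¹ / 2 * (w (n + 1) * ‖b‖ ^ 2)) := by
    refine neg_mul_le_abs_mul _ _ _ ?_
    have h1 : |(starRingEnd ℂ a * c).re + (starRingEnd ℂ a * b).re|
        ≤ ‖a‖ * ‖c‖ + ‖a‖ * ‖b‖ := by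
      refine (abs_add_le _ _).trans ?_
      exact add_le_add (abs_re_conj_mul_le a c) (abs_re_conj_mul_le a b)
    have h2 : ‖a‖ * ‖c‖ + ‖a‖ * ‖b‖ ≤ ‖a‖ ^ 2 + ‖c‖ ^ 2 / 2 + ‖b‖ ^ 2 / 2 := by
      have := two_mul_le_add_sq ‖a‖ ‖c‖
      have := two_mul_le_add_sq ‖a‖ ‖b‖
      linarith
    have h3 : w n * ‖c‖ ^ 2 ≤ dup * (w (n - 1) * ‖c‖ ^ 2) := by
      have := hw.le_up (n - 1)
      rw [sub_add_cancel] at this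
      rw [← mul_assoc]
      gcongr
    have h4 : w n * ‖b‖ ^ 2 ≤ dlow⁻¹ * (w (n + 1) * ‖b‖ ^ 2) := by
      rw [inv_mul_eq_div, le_div_iff₀ hw.dlow_pos]
      have := mul_le_mul_of_nonneg_right (hw.low_le n) (sq_nonneg ‖b‖)
      linarith
    rw [abs_mul, abs_of_pos hw0]
    have h5 := mul_le_mul_of_nonneg_left (h1.trans h2) hw0.le
    linarith
  have hg : w n * (starRingEnd ℂ a * g n).im
      ≤ ε / 2 * (w n * ‖a‖ ^ 2) + 1 / (2 * ε) * (w n * ‖g n‖ ^ 2) := by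
    have h1 : (starRingEnd ℂ a * g n).im ≤ ‖a‖ * ‖g n‖ :=
      (le_abs_self _).trans (abs_im_conj_mul_le a (g n))
    have h2 : ‖a‖ * ‖g n‖ ≤ ε / 2 * ‖a‖ ^ 2 + 1 / (2 * ε) * ‖g n‖ ^ 2 := by
      have h3 : ε / 2 * ‖a‖ ^ 2 + 1 / (2 * ε) * ‖g n‖ ^ 2 - ‖a‖ * ‖g n‖
          = (ε * ‖a‖ - ‖g n‖) ^ 2 / (2 * ε) := by
        field_simp
        ring
      have h4 : 0 ≤ (ε * ‖a‖ - ‖g n‖) ^ 2 / (2 * ε) := by positivity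
      linarith
    have h5 := mul_le_mul_of_nonneg_left (h1.trans h2) hw0.le
    linarith
  linarith

end LatticeParams

/-- The energy of a sequence with respect to the weight `w`. -/
def weightedEnergy (w : ℤ → ℝ) (u : ℤ → ℂ) : ℝ := ∑' n, w n * ‖u n‖ ^ 2

namespace WeightedEll2

variable {θ : LatticeWeight} {w : ℤ → ℝ}

theorem summable_weight_mul_sq (hw0 : ∀ n, 0 ≤ w n) (hwθ : ∀ n, w n ≤ θ n)
    (u : WeightedEll2 θ) : Summable fun n => w n * ‖u n‖ ^ 2 :=
  Summable.of_nonneg_of_le (fun n => mul_nonneg (hw0 n) (sq_nonneg _))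
    (fun n => mul_le_mul_of_nonneg_right (hwθ n) (sq_nonneg _)) u.summable_sq

theorem hasSum_weightedEnergy (hw0 : ∀ n, 0 ≤ w n) (hwθ : ∀ n, w n ≤ θ n) (u : WeightedEll2 θ) :
    HasSum (fun n => w n * ‖u n‖ ^ 2) (weightedEnergy w u) :=
  (summable_weight_mul_sq hw0 hwθ u).hasSum

theorem weightedEnergy_nonneg (hw0 : ∀ n, 0 ≤ w n) (u : ℤ → ℂ) : 0 ≤ weightedEnergy w u :=
  tsum_nonneg fun n => mul_nonneg (hw0 n) (sq_nonneg _)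

theorem weightedEnergy_le_norm_sq (hw0 : ∀ n, 0 ≤ w n) (hwθ : ∀ n, w n ≤ θ n)
    (u : WeightedEll2 θ) : weightedEnergy w u ≤ ‖u‖ ^ 2 :=
  hasSum_le (fun n => mul_le_mul_of_nonneg_right (hwθ n) (sq_nonneg _))
    (hasSum_weightedEnergy hw0 hwθ u) u.hasSum_norm_sq

theorem weightedEnergy_self (u : WeightedEll2 θ) : weightedEnergy θ u = ‖u‖ ^ 2 :=
  (norm_sq_eq u).symm

theorem abs_sqrt_weight_div_le (hwθ : ∀ n, w n ≤ θ n) (n : ℤ) :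
    |Real.sqrt (w n / θ n)| ≤ 1 := by
  rw [abs_of_nonneg (Real.sqrt_nonneg _)]
  exact Real.sqrt_le_one.2 ((div_le_one (θ.pos n)).2 (hwθ n))

theorem mul_sqrt_weight_div_sq (hw0 : ∀ n, 0 ≤ w n) (n : ℤ) :
    θ n * Real.sqrt (w n / θ n) ^ 2 = w n := by
  rw [Real.sq_sqrt (div_nonneg (hw0 n) (θ.pos n).le), mul_div_cancel₀ _ (θ.pos n).ne']

theorem hasSum_weight_mul_re (hw0 : ∀ n, 0 ≤ w n) (hwθ : ∀ n, w n ≤ θ n) (u v : WeightedEll2 θ) :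
    HasSum (fun n => w n * (starRingEnd ℂ (u n) * v n).re)
      (inner ℝ (mulOp _ (abs_sqrt_weight_div_le hwθ) u)
        (mulOp _ (abs_sqrt_weight_div_le hwθ) v)) := by
  convert hasSum_real_inner (mulOp _ (abs_sqrt_weight_div_le hwθ) u)
    (mulOp _ (abs_sqrt_weight_div_le hwθ) v) using 2 with n
  rw [mulOp_apply, mulOp_apply, map_mul, Complex.conj_ofReal, mul_mul_mul_comm,
    ← Complex.ofReal_mul, Complex.re_ofReal_mul, ← sq, ← mul_assoc, mul_sqrt_weight_div_sq hw0]

theorem norm_mulOp_sq (hw0 : ∀ n, 0 ≤ w n) (hwθ : ∀ n, w n ≤ θ n) (u : WeightedEll2 θ) :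
    ‖mulOp _ (abs_sqrt_weight_div_le hwθ) u‖ ^ 2 = weightedEnergy w u := by
  rw [norm_sq_eq]
  refine tsum_congr fun n => ?_
  rw [mulOp_apply, norm_mul, mul_pow, Complex.norm_real, Real.norm_eq_abs, sq_abs, ← mul_assoc,
    mul_sqrt_weight_div_sq hw0]

/-- The weighted energy is the squared norm after the bounded multiplication by `√(w / θ)`, so the
chain rule replaces termwise differentiation of the series. -/
theorem hasDerivWithinAt_weightedEnergy (hw0 : ∀ n, 0 ≤ w n) (hwθ : ∀ n, w n ≤ θ n)
    {u : ℝ → WeightedEll2 θ} {v : WeightedEll2 θ} {J : Set ℝ} {t : ℝ}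
    (hu : HasDerivWithinAt u v J t) :
    HasDerivWithinAt (fun t => weightedEnergy w (u t))
      (2 * ∑' n, w n * (starRingEnd ℂ (u t n) * v n).re) J t := by
  have h := ((mulOp _ (abs_sqrt_weight_div_le hwθ)).hasFDerivAt.comp_hasDerivWithinAt t
    hu).norm_sq
  rw [(hasSum_weight_mul_re hw0 hwθ (u t) v).tsum_eq]
  simpa only [Function.comp_apply, norm_mulOp_sq hw0 hwθ] using h

end WeightedEll2

namespace LatticeParams

variable (P : LatticeParams) {θ : LatticeWeight} {w : ℤ → ℝ}

theorem summable_weight_mul_rpow (hp : 1 < P.p) (hw0 : ∀ n, 0 ≤ w n) (hwθ : ∀ n, w n ≤ θ n)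
    (u : WeightedEll2 θ) : Summable fun n => w n * (‖u n‖ ^ (P.p - 1) * ‖u n‖ ^ 2) := by
  refine Summable.of_nonneg_of_le (fun n => mul_nonneg (hw0 n) (by positivity)) (fun n => ?_)
    (u.summable_sq.mul_left (‖u‖ ^ (P.p - 1)))
  have h1 : ‖u n‖ ^ (P.p - 1) ≤ ‖u‖ ^ (P.p - 1) :=
    Real.rpow_le_rpow (norm_nonneg _) (u.norm_apply_le n) (by linarith)
  calc _ ≤ θ n * (‖u‖ ^ (P.p - 1) * ‖u n‖ ^ 2) :=
        mul_le_mul (hwθ n) (by gcongr) (by positivity) (θ.pos n).le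
    _ = _ := by ring

/-- The energy inequality for the right hand side of the lattice equation. -/
theorem tsum_weight_mul_re_field_le {D dlow dup D₁ dlow₁ dup₁ ε : ℝ} (hθ : θ.WS D dlow dup)
    (hp : 1 < P.p) (hw : IsSlowWeight w D₁ dlow₁ dup₁) (hwθ : ∀ n, w n ≤ θ n) (hε : 0 < ε)
    (g u : WeightedEll2 θ) :
    ∑' n, w n * (starRingEnd ℂ (u n) * P.field hθ hp g u n).re
      ≤ -P.sigma0 ε D₁ dlow₁ dup₁ * weightedEnergy w u
        - P.ζ * ∑' n, w n * (‖u n‖ ^ (P.p - 1) * ‖u n‖ ^ 2)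
        + 1 / (2 * ε) * weightedEnergy w g := by
  have hw0 : ∀ n, 0 ≤ w n := fun n => (hw.pos n).le
  have hx := WeightedEll2.hasSum_weightedEnergy hw0 hwθ u
  have hx1 : HasSum (fun n => w (n + 1) * ‖u (n + 1)‖ ^ 2) (weightedEnergy w u) := by
    simpa only [Function.comp_def, Equiv.coe_addRight] using
      (Equiv.addRight (1 : ℤ)).hasSum_iff.2 hx
  have hxm : HasSum (fun n => w (n - 1) * ‖u (n - 1)‖ ^ 2) (weightedEnergy w u) := by
    simpa only [Function.comp_def, Equiv.subRight_apply] using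
      (Equiv.subRight (1 : ℤ)).hasSum_iff.2 hx
  have hy := (P.summable_weight_mul_rpow hp hw0 hwθ u).hasSum
  have hgs := WeightedEll2.hasSum_weightedEnergy hw0 hwθ g
  have hb : Summable fun n => w n * (starRingEnd ℂ (u (n - 1)) * u n).im := by
    refine Summable.of_norm_bounded (hx.summable.add (hxm.summable.mul_left dup₁)) fun n => ?_
    rw [norm_mul, Real.norm_of_nonneg (hw0 n), Real.norm_eq_abs]
    have h1 := abs_im_conj_mul_le (u (n - 1)) (u n)
    have h2 : ‖u (n - 1)‖ * ‖u n‖ ≤ ‖u n‖ ^ 2 + ‖u (n - 1)‖ ^ 2 := by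
      nlinarith [two_mul_le_add_sq ‖u (n - 1)‖ ‖u n‖, sq_nonneg ‖u n‖, sq_nonneg ‖u (n - 1)‖]
    have h3 := hw.le_up (n - 1)
    rw [sub_add_cancel] at h3
    have h4 := mul_le_mul_of_nonneg_left (h1.trans h2) (hw0 n)
    have h5 := mul_le_mul_of_nonneg_right h3 (sq_nonneg ‖u (n - 1)‖)
    linarith
  have hb1 : HasSum (fun n => w (n + 1) * (starRingEnd ℂ (u n) * u (n + 1)).im)
      (∑' n, w n * (starRingEnd ℂ (u (n - 1)) * u n).im) := by
    have := (Equiv.addRight (1 : ℤ)).hasSum_iff.2 hb.hasSum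
    simpa only [Function.comp_def, Equiv.coe_addRight, add_sub_cancel_right] using this
  -- The two current sums are equal by translation and cancel; all shifted energies equal
  -- `weightedEnergy w u`, and their coefficients add up to `-sigma0`.
  have hsum := (((((hb1.mul_left (-P.α)).add (hb.hasSum.mul_left P.α)).add
    (((hx.add hx1).div_const 2).mul_left (|P.α| * D₁ * dlow₁ ^ (-(1 / 2) : ℝ)))).add
    (((hx.add (hxm.mul_left (dup₁ / 2))).add (hx1.mul_left (dlow₁⁻¹ / 2))).mul_left |P.β|)).add
    (hx.mul_left (2 * P.β - P.δ + ε / 2))).sub (hy.mul_left P.ζ) |>.add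
    (hgs.mul_left (1 / (2 * ε)))
  have hfield := (WeightedEll2.hasSum_weight_mul_re hw0 hwθ u (P.field hθ hp g u)).summable.hasSum
  refine (hasSum_le (fun n => ?_) hfield hsum).trans (le_of_eq ?_)
  · rw [field_apply]
    exact P.weight_mul_re_le hw hε u g n
  unfold sigma0
  ring

end LatticeParams

/-! ### Construction of slowly varying weights -/

section Weights

/-- The product rule for increments. The new constants tend to the old ones as `κ → 0`. -/
theorem IsSlowWeight.mul_of_ratio_le {v ψ : ℤ → ℝ} {D dlow dup κ : ℝ}
    (hv : IsSlowWeight v D dlow dup) (hκ : 0 ≤ κ) (hψ : ∀ n, 0 < ψ n)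
    (hup : ∀ n, ψ (n + 1) ≤ Real.exp κ * ψ n) (hdn : ∀ n, ψ n ≤ Real.exp κ * ψ (n + 1)) :
    IsSlowWeight (fun n => v n * ψ n) (D + dup * (Real.exp κ - 1)) (dlow * Real.exp (-κ))
      (dup * Real.exp κ) := by
  have hexp : 1 ≤ Real.exp κ := Real.one_le_exp hκ
  have hdup : 0 < dup := by
    have := (hv.pos (0 + 1)).trans_le (hv.le_up 0)
    exact pos_of_mul_pos_left this (hv.pos 0).le
  have hdn' : ∀ n, Real.exp (-κ) * ψ n ≤ ψ (n + 1) := fun n => by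
    rw [Real.exp_neg, inv_mul_eq_div, div_le_iff₀ (Real.exp_pos κ), mul_comm]
    exact hdn n
  have hneg : 1 - Real.exp (-κ) ≤ Real.exp κ - 1 := by
    have h1 := Real.add_one_le_exp κ
    have h2 := Real.add_one_le_exp (-κ)
    linarith
  refine ⟨fun n => mul_pos (hv.pos n) (hψ n), ?_, mul_pos hv.dlow_pos (Real.exp_pos _), ?_, ?_, ?_⟩
  · have := hv.D_nonneg
    have : 0 ≤ dup * (Real.exp κ - 1) := mul_nonneg hdup.le (by linarith)
    linarith
  · intro n
    have h1 : |ψ (n + 1) - ψ n| ≤ (Real.exp κ - 1) * ψ n := by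
      have h2 := mul_le_mul_of_nonneg_right hneg (hψ n).le
      have h3 := hup n
      have h4 := hdn' n
      rw [abs_le]
      constructor <;> linarith
    have h2 : v (n + 1) * |ψ (n + 1) - ψ n| ≤ dup * v n * ((Real.exp κ - 1) * ψ n) :=
      mul_le_mul (hv.le_up n) h1 (abs_nonneg _) (mul_nonneg hdup.le (hv.pos n).le)
    have h3 : |v (n + 1) - v n| * ψ n ≤ D * v n * ψ n :=
      mul_le_mul_of_nonneg_right (hv.diff_le n) (hψ n).le
    calc |v (n + 1) * ψ (n + 1) - v n * ψ n|
        = |v (n + 1) * (ψ (n + 1) - ψ n) + (v (n + 1) - v n) * ψ n| := by congr 1; ring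
      _ ≤ v (n + 1) * |ψ (n + 1) - ψ n| + |v (n + 1) - v n| * ψ n := by
        refine (abs_add_le _ _).trans ?_
        rw [abs_mul, abs_mul, abs_of_pos (hv.pos _), abs_of_pos (hψ n)]
      _ ≤ _ := by linarith
  · intro n
    calc dlow * Real.exp (-κ) * (v n * ψ n) = dlow * v n * (Real.exp (-κ) * ψ n) := by ring
      _ ≤ _ := mul_le_mul (hv.low_le n) (hdn' n)
        (mul_nonneg (Real.exp_pos _).le (hψ n).le) (hv.pos _).le
  · intro n
    calc v (n + 1) * ψ (n + 1) ≤ dup * v n * (Real.exp κ * ψ n) :=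
        mul_le_mul (hv.le_up n) (hup n) (hψ _).le (mul_nonneg hdup.le (hv.pos n).le)
      _ = _ := by ring

namespace LatticeWeight.WS

variable {θ : LatticeWeight} {D dlow dup : ℝ}

/-- The step from `-1` to `0` goes towards the origin, where the weight cannot increase. With
`one_le_dup` this lets the quotient bounds survive truncation at a constant. -/
theorem dlow_le_one (hθ : θ.WS D dlow dup) : dlow ≤ 1 := by
  have h1 := hθ.low_le (-1)
  have h2 := hθ.mono (-1 + 1) (-1) (by norm_num)
  have h3 := θ.pos (-1)
  by_contra! h
  nlinarith

theorem one_le_dup (hθ : θ.WS D dlow dup) : 1 ≤ dup := by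
  have h1 := hθ.le_up 0
  have h2 := hθ.mono 0 (0 + 1) (by norm_num)
  have h3 := θ.pos 0
  by_contra! h
  nlinarith

theorem isSlowWeight_min (hθ : θ.WS D dlow dup) {c : ℝ} (hc : 0 < c) :
    IsSlowWeight (fun n => min (θ n) c) D dlow dup := by
  refine ⟨fun n => lt_min (θ.pos n) hc, hθ.D_pos.le, hθ.dlow_pos, ?_, ?_, ?_⟩
  · intro n
    have h1 := hθ.diff_le n
    rcases le_total (θ n) c with h | h
    · rw [min_eq_left h]
      have h2 := abs_min_sub_min_le_max (θ (n + 1)) c (θ n) c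
      rw [sub_self, abs_zero, max_eq_left (abs_nonneg _), min_eq_left h] at h2
      exact h2.trans h1
    · rw [min_eq_right h]
      rcases le_total c (θ (n + 1)) with h' | h'
      · rw [min_eq_right h', sub_self, abs_zero]
        exact mul_nonneg hθ.D_pos.le hc.le
      · rw [min_eq_left h', abs_sub_comm, abs_of_nonneg (by linarith)]
        have h2 := (abs_le.1 h1).1
        have h3 := θ.pos (n + 1)
        -- Here the weight drops through the level `c`. For `D ≥ 1` the drop below `c` is at most `c
        -- ≤ D c`; for `D ≤ 1`, `θ (n + 1) ≥ (1 - D) θ n ≥ (1 - D) c`.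
        rcases le_total 1 D with hD | hD
        · nlinarith
        · nlinarith
  · intro n
    have h1 := hθ.low_le n
    have h2 := mul_le_mul_of_nonneg_left (min_le_left (θ n) c) hθ.dlow_pos.le
    have h3 := mul_le_mul hθ.dlow_le_one (min_le_right (θ n) c)
      (lt_min (θ.pos n) hc).le zero_le_one
    exact le_min (h2.trans h1) (by linarith)
  · intro n
    rw [mul_min_of_nonneg _ _ hθ.dup_pos.le]
    refine min_le_min (hθ.le_up n) ?_
    exact le_mul_of_one_le_left hc.le hθ.one_le_dup

end LatticeWeight.WS

theorem abs_intCast_succ_le (n : ℤ) : |((n + 1 : ℤ) : ℝ)| ≤ |(n : ℝ)| + 1 := by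
  push_cast
  exact (abs_add_le _ _).trans (by simp)

theorem abs_intCast_le_succ (n : ℤ) : |(n : ℝ)| ≤ |((n + 1 : ℤ) : ℝ)| + 1 := by
  push_cast
  have := abs_sub ((n : ℝ) + 1) 1
  simpa using this

/-- A slowly varying weight which equals `1` for `|n| ≥ K` and is small for small `|n|`. -/
def outerWeight (κ : ℝ) (K : ℕ) (n : ℤ) : ℝ := min 1 (Real.exp (κ * (|(n : ℝ)| - K)))

theorem outerWeight_pos (κ : ℝ) (K : ℕ) (n : ℤ) : 0 < outerWeight κ K n :=
  lt_min one_pos (Real.exp_pos _)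

theorem outerWeight_le_one (κ : ℝ) (K : ℕ) (n : ℤ) : outerWeight κ K n ≤ 1 := min_le_left _ _

theorem outerWeight_le_exp_mul {κ : ℝ} (hκ : 0 ≤ κ) (K : ℕ) {m n : ℤ}
    (h : |(m : ℝ)| ≤ |(n : ℝ)| + 1) :
    outerWeight κ K m ≤ Real.exp κ * outerWeight κ K n := by
  unfold outerWeight
  rw [mul_min_of_nonneg _ _ (Real.exp_pos κ).le, mul_one, ← Real.exp_add]
  refine min_le_min (Real.one_le_exp hκ) (Real.exp_le_exp.2 ?_)
  nlinarith

theorem outerWeight_eq_one {κ : ℝ} (hκ : 0 ≤ κ) {K : ℕ} {n : ℤ} (h : (K : ℝ) ≤ |(n : ℝ)|) :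
    outerWeight κ K n = 1 :=
  min_eq_left (Real.one_le_exp (mul_nonneg hκ (by linarith)))

theorem tendsto_outerWeight {κ : ℝ} (hκ : 0 < κ) (n : ℤ) :
    Tendsto (fun K : ℕ => outerWeight κ K n) atTop (𝓝 0) := by
  have h1 : Tendsto (fun K : ℕ => κ * (|(n : ℝ)| - K)) atTop atBot := by
    refine Tendsto.const_mul_atBot hκ ?_
    exact tendsto_atBot_add_const_left _ _ (tendsto_neg_atTop_atBot.comp tendsto_natCast_atTop_atTop)
  refine squeeze_zero (fun K => (outerWeight_pos κ K n).le) (fun K => min_le_right _ _)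
    (Real.tendsto_exp_atBot.comp h1)

theorem summable_exp_neg_mul_abs {κ : ℝ} (hκ : 0 < κ) :
    Summable fun n : ℤ => Real.exp (-κ * |(n : ℝ)|) := by
  have h : Summable fun n : ℕ => Real.exp (-κ * n) := by
    have := summable_geometric_of_lt_one (Real.exp_pos (-κ)).le
      (Real.exp_lt_one_iff.2 (by linarith : -κ < 0))
    refine this.congr fun n => ?_
    rw [← Real.exp_nat_mul, mul_comm]
  refine Summable.of_nat_of_neg ?_ ?_
  · simpa using h
  · simpa using h

theorem exp_neg_mul_abs_le_exp_mul {κ : ℝ} (hκ : 0 ≤ κ) {m n : ℤ}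
    (h : |(n : ℝ)| ≤ |(m : ℝ)| + 1) :
    Real.exp (-κ * |(m : ℝ)|) ≤ Real.exp κ * Real.exp (-κ * |(n : ℝ)|) := by
  rw [← Real.exp_add]
  refine Real.exp_le_exp.2 ?_
  nlinarith

end Weights

/-! ### Decay and nonlinear damping of weighted energies -/

namespace LatticeParams

variable (P : LatticeParams) {θ : LatticeWeight} {w : ℤ → ℝ} {D dlow dup D₁ dlow₁ dup₁ ε : ℝ}

theorem tendsto_sigma0 (ε D dup : ℝ) (hdlow : 0 < dlow) :
    Tendsto (fun κ : ℝ => P.sigma0 ε (D + dup * (Real.exp κ - 1)) (dlow * Real.exp (-κ))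
      (dup * Real.exp κ)) (𝓝[>] 0) (𝓝 (P.sigma0 ε D dlow dup)) := by
  have hc : ContinuousAt (fun κ : ℝ => P.sigma0 ε (D + dup * (Real.exp κ - 1))
      (dlow * Real.exp (-κ)) (dup * Real.exp κ)) 0 := by
    have h0 : dlow * Real.exp (-(0 : ℝ)) ≠ 0 := by simp [hdlow.ne']
    have h1 : ContinuousAt (fun κ : ℝ => dlow * Real.exp (-κ)) 0 := by fun_prop
    have h2 : ContinuousAt (fun κ : ℝ => (dlow * Real.exp (-κ)) ^ (-(1 / 2) : ℝ)) 0 :=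
      h1.rpow_const (Or.inl h0)
    have h3 : ContinuousAt (fun κ : ℝ => (dlow * Real.exp (-κ))⁻¹) 0 := h1.inv₀ h0
    have h4 : ContinuousAt (fun κ : ℝ => |P.α| * (D + dup * (Real.exp κ - 1))) 0 := by fun_prop
    have h5 : ContinuousAt (fun κ : ℝ => 1 + dup * Real.exp κ / 2) 0 := by fun_prop
    exact (continuousAt_const.sub (h4.mul h2)).sub
      (continuousAt_const.mul (h5.add (h3.div_const 2)))
  have := hc.tendsto.mono_left (nhdsWithin_le_nhds (s := Set.Ioi (0 : ℝ)))
  simpa using this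

theorem hasDerivWithinAt_weightedEnergy_right (hθ : θ.WS D dlow dup) (hp : 1 < P.p)
    (hw0 : ∀ n, 0 ≤ w n) (hwθ : ∀ n, w n ≤ θ n) {g : WeightedEll2 θ} {u : ℝ → WeightedEll2 θ}
    (hu : IsTrajectoryOn (P.field hθ hp g) (Set.Ici 0) u) {t : ℝ} (ht : 0 ≤ t) :
    HasDerivWithinAt (fun t => weightedEnergy w (u t))
      (2 * ∑' n, w n * (starRingEnd ℂ (u t n) * P.field hθ hp g (u t) n).re) (Set.Ici t) t :=
  (WeightedEll2.hasDerivWithinAt_weightedEnergy hw0 hwθ (hu t ht)).mono (Set.Ici_subset_Ici.2 ht)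

theorem continuousOn_weightedEnergy (hθ : θ.WS D dlow dup) (hp : 1 < P.p)
    (hw0 : ∀ n, 0 ≤ w n) (hwθ : ∀ n, w n ≤ θ n) {g : WeightedEll2 θ} {u : ℝ → WeightedEll2 θ}
    (hu : IsTrajectoryOn (P.field hθ hp g) (Set.Ici 0) u) :
    ContinuousOn (fun t => weightedEnergy w (u t)) (Set.Ici 0) := fun t ht =>
  (WeightedEll2.hasDerivWithinAt_weightedEnergy hw0 hwθ (hu t ht)).continuousWithinAt

theorem tsum_rpow_nonneg (hw0 : ∀ n, 0 ≤ w n) (u : ℤ → ℂ) :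
    0 ≤ ∑' n, w n * (‖u n‖ ^ (P.p - 1) * ‖u n‖ ^ 2) :=
  tsum_nonneg fun n => mul_nonneg (hw0 n) (by positivity)

/-- Exponential decay of the weighted energy, up to the contribution of the forcing. -/
theorem weightedEnergy_le (hθ : θ.WS D dlow dup) (hp : 1 < P.p)
    (hw : IsSlowWeight w D₁ dlow₁ dup₁) (hwθ : ∀ n, w n ≤ θ n) (hε : 0 < ε)
    (hσ : 0 < P.sigma0 ε D₁ dlow₁ dup₁) (hζ : 0 < P.ζ) {g : WeightedEll2 θ}
    {u : ℝ → WeightedEll2 θ} (hu : IsTrajectoryOn (P.field hθ hp g) (Set.Ici 0) u) {t : ℝ}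
    (ht : 0 ≤ t) :
    weightedEnergy w (u t)
      ≤ weightedEnergy w (u 0) * Real.exp (-(2 * P.sigma0 ε D₁ dlow₁ dup₁) * t)
        + weightedEnergy w g / (2 * P.sigma0 ε D₁ dlow₁ dup₁ * ε) := by
  have hw0 : ∀ n, 0 ≤ w n := fun n => (hw.pos n).le
  have h := le_exp_decay_of_deriv_right_le (a := 0) (b := t) (k := 2 * P.sigma0 ε D₁ dlow₁ dup₁)
    (c := weightedEnergy w g / ε) (by positivity)
    (div_nonneg (WeightedEll2.weightedEnergy_nonneg hw0 _) hε.le)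
    ((P.continuousOn_weightedEnergy hθ hp hw0 hwθ hu).mono Set.Icc_subset_Ici_self)
    (fun s hs => P.hasDerivWithinAt_weightedEnergy_right hθ hp hw0 hwθ hu hs.1)
    (fun s hs => ?_) t ⟨ht, le_rfl⟩
  · rwa [sub_zero, div_div, mul_comm ε] at h
  · have h1 := P.tsum_weight_mul_re_field_le hθ hp hw hwθ hε g (u s)
    have h2 := mul_nonneg hζ.le (P.tsum_rpow_nonneg hw0 (u s))
    have h3 : weightedEnergy w g / ε = 2 * (1 / (2 * ε) * weightedEnergy w g) := by
      field_simp
    rw [h3]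
    linarith

/-- Jensen's inequality for the probability weights `w n / W` and the convex power `q = (p + 1) / 2`
of `‖u n‖²`: the tangent inequality at the mean `E / W` is summed, and its linear part sums to zero.
-/
theorem rpow_le_tsum (hp : 1 < P.p) (hw0 : ∀ n, 0 < w n) (hwθ : ∀ n, w n ≤ θ n)
    (hws : Summable w) (u : WeightedEll2 θ) :
    (∑' n, w n) ^ (1 - (P.p + 1) / 2) * weightedEnergy w u ^ ((P.p + 1) / 2)
      ≤ ∑' n, w n * (‖u n‖ ^ (P.p - 1) * ‖u n‖ ^ 2) := by
  have hw0' : ∀ n, 0 ≤ w n := fun n => (hw0 n).le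
  have hW : 0 < ∑' n, w n := hws.tsum_pos hw0' 0 (hw0 0)
  set W := ∑' n, w n with hWdef
  have hx := WeightedEll2.hasSum_weightedEnergy hw0' hwθ u
  set E := weightedEnergy w u with hE
  set q := (P.p + 1) / 2 with hq
  rcases (WeightedEll2.weightedEnergy_nonneg hw0' u).eq_or_lt with h0 | h0
  · rw [hE, ← h0, Real.zero_rpow (by rw [hq]; linarith), mul_zero]
    exact P.tsum_rpow_nonneg hw0' u
  have hl : 0 < E / W := div_pos h0 hW
  have hpt : ∀ n, w n * ((E / W) ^ q + q * (E / W) ^ (q - 1) * (‖u n‖ ^ 2 - E / W))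
      ≤ w n * (‖u n‖ ^ (P.p - 1) * ‖u n‖ ^ 2) := by
    intro n
    refine mul_le_mul_of_nonneg_left ?_ (hw0' n)
    refine (Real.add_mul_sub_le_rpow (sq_nonneg _) hl (by rw [hq]; linarith)).trans (le_of_eq ?_)
    rw [← Real.rpow_natCast, ← Real.rpow_mul (norm_nonneg _),
      ← Real.rpow_add_of_nonneg (norm_nonneg _) (by linarith) (by norm_num)]
    congr 1
    rw [hq]
    push_cast
    ring
  have hsum : HasSum
      (fun n => w n * ((E / W) ^ q + q * (E / W) ^ (q - 1) * (‖u n‖ ^ 2 - E / W)))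
      (W * (E / W) ^ q + q * (E / W) ^ (q - 1) * (E - W * (E / W))) := by
    have h1 := (hws.hasSum.mul_right ((E / W) ^ q)).add
      ((hx.sub (hws.hasSum.mul_right (E / W))).mul_left (q * (E / W) ^ (q - 1)))
    refine Eq.mp (congrArg (fun f => HasSum f _) (funext fun n => ?_)) h1
    ring
  refine le_trans (le_of_eq ?_)
    (hasSum_le hpt hsum (P.summable_weight_mul_rpow hp hw0' hwθ u).hasSum)
  rw [mul_div_cancel₀ _ hW.ne', sub_self, mul_zero, add_zero, Real.div_rpow h0.le hW.le,
    Real.rpow_sub hW, Real.rpow_one]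
  ring

/-- For a summable weight the nonlinear damping bounds the energy at time `1` independently of
the initial state. -/
theorem exists_weightedEnergy_at_one_le (hθ : θ.WS D dlow dup) (hp : 1 < P.p)
    (hw : IsSlowWeight w D₁ dlow₁ dup₁) (hwθ : ∀ n, w n ≤ θ n) (hws : Summable w) (hε : 0 < ε)
    (hσ : 0 < P.sigma0 ε D₁ dlow₁ dup₁) (hζ : 0 < P.ζ) (g : WeightedEll2 θ) :
    ∃ M : ℝ, ∀ u : ℝ → WeightedEll2 θ, IsTrajectoryOn (P.field hθ hp g) (Set.Ici 0) u →
      weightedEnergy w (u 1) ≤ M := by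
  have hw0 : ∀ n, 0 ≤ w n := fun n => (hw.pos n).le
  have hW : 0 < ∑' n, w n := hws.tsum_pos hw0 0 (hw.pos 0)
  refine ⟨_, fun u hu => le_of_superlinear_damping (k := 2 * P.sigma0 ε D₁ dlow₁ dup₁)
    (c := weightedEnergy w g / ε) (b₀ := 2 * P.ζ * (∑' n, w n) ^ (1 - (P.p + 1) / 2))
    (q := (P.p + 1) / 2) (by positivity)
    (div_nonneg (WeightedEll2.weightedEnergy_nonneg hw0 _) hε.le) (by positivity)
    (by linarith)
    ((P.continuousOn_weightedEnergy hθ hp hw0 hwθ hu).mono Set.Icc_subset_Ici_self)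
    (fun s => WeightedEll2.weightedEnergy_nonneg hw0 _)
    (fun s hs => P.hasDerivWithinAt_weightedEnergy_right hθ hp hw0 hwθ hu hs.1)
    (fun s _ => ?_)⟩
  have h1 := P.tsum_weight_mul_re_field_le hθ hp hw hwθ hε g (u s)
  have h2 := mul_le_mul_of_nonneg_left (P.rpow_le_tsum hp hw.pos hwθ hws (u s)) hζ.le
  have h3 : weightedEnergy w g / ε = 2 * (1 / (2 * ε) * weightedEnergy w g) := by
    field_simp
  rw [h3]
  linarith

end LatticeParams

/-! ### Truncations and tails -/

namespace WeightedEll2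

variable {θ : LatticeWeight}

/-- The `n`-th unit vector. -/
def unitVector (θ : LatticeWeight) (n : ℤ) : WeightedEll2 θ :=
  ⟨Pi.single n 1, summable_of_ne_finset_zero (s := {n}) fun m hm => by
    rw [Finset.mem_singleton] at hm
    simp [Pi.single_eq_of_ne hm]⟩

theorem unitVector_apply (n m : ℤ) : unitVector θ n m = if m = n then 1 else 0 :=
  Pi.single_apply n 1 m

/-- The `n`-th coordinate as a linear map. -/
def coord (θ : LatticeWeight) (n : ℤ) : WeightedEll2 θ →ₗ[ℂ] ℂ where
  toFun u := u n
  map_add' _ _ := rfl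
  map_smul' _ _ := rfl

/-- The finitely supported sequence with the coordinates of `x` on `s`. -/
def truncate (θ : LatticeWeight) (s : Finset ℤ) (x : ℤ → ℂ) : WeightedEll2 θ :=
  ∑ n ∈ s, x n • unitVector θ n

theorem continuous_truncate (s : Finset ℤ) : Continuous (truncate θ s) := by
  unfold truncate
  fun_prop

theorem truncate_apply (s : Finset ℤ) (x : ℤ → ℂ) (m : ℤ) :
    truncate θ s x m = if m ∈ s then x m else 0 := by
  change coord θ m (truncate θ s x) = _
  rw [truncate, map_sum]
  simp only [map_smul]
  change ∑ n ∈ s, x n • (unitVector θ n) m = _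
  simp [unitVector_apply]

/-- Truncation is continuous for the product topology of `ℤ → ℂ`, where Tychonoff's theorem makes
the product of balls compact. -/
theorem isCompact_truncate_image (s : Finset ℤ) (R : ℝ) :
    IsCompact (truncate θ s '' Set.univ.pi fun _ => Metric.closedBall 0 R) :=
  (isCompact_univ_pi fun _ => isCompact_closedBall _ _).image (continuous_truncate s)

theorem norm_sub_truncate_sq_le {w : ℤ → ℝ} (hw0 : ∀ n, 0 ≤ w n) (hwθ : ∀ n, w n ≤ θ n)
    {s : Finset ℤ} (hs : ∀ n ∉ s, w n = θ n) (u : WeightedEll2 θ) :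
    ‖u - truncate θ s u‖ ^ 2 ≤ weightedEnergy w u := by
  refine hasSum_le (fun n => ?_) (hasSum_norm_sq _) (hasSum_weightedEnergy hw0 hwθ u)
  rw [sub_apply, truncate_apply]
  split_ifs with hn
  · rw [sub_self, norm_zero, zero_pow two_ne_zero, mul_zero]
    exact mul_nonneg (hw0 n) (sq_nonneg _)
  · rw [sub_zero, hs n hn]

theorem tendsto_weightedEnergy_outerWeight {κ : ℝ} (hκ : 0 < κ) (g : WeightedEll2 θ) :
    Tendsto (fun K : ℕ => weightedEnergy (fun n => θ n * outerWeight κ K n) g) atTop (𝓝 0) := by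
  have h := tendsto_tsum_of_dominated_convergence (𝓕 := atTop)
    (f := fun (K : ℕ) n => θ n * outerWeight κ K n * ‖g n‖ ^ 2) (g := fun _ => (0 : ℝ))
    g.summable_sq (fun n => ?_) (Eventually.of_forall fun K n => ?_)
  · simpa [weightedEnergy] using h
  · have := ((tendsto_outerWeight hκ n).const_mul (θ n)).mul_const (‖g n‖ ^ 2)
    simpa using this
  · have h1 := (θ.pos n).le
    have h2 := (outerWeight_pos κ K n).le
    rw [Real.norm_of_nonneg (by positivity)]
    exact mul_le_mul_of_nonneg_right (mul_le_of_le_one_right h1 (outerWeight_le_one κ K n))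
      (sq_nonneg _)

end WeightedEll2

/-! ### Solution operator, asymptotic compactness, invariant sets -/

namespace LatticeParams

variable (P : LatticeParams) {θ : LatticeWeight} {D dlow dup ε : ℝ} {g : WeightedEll2 θ}
  {S : ℝ → WeightedEll2 θ → WeightedEll2 θ}

theorem norm_sq_le (hθ : θ.WS D dlow dup) (hp : 1 < P.p) (hε : 0 < ε)
    (hσ : 0 < P.sigma0 ε D dlow dup) (hζ : 0 < P.ζ)
    {u : ℝ → WeightedEll2 θ} (hu : IsTrajectoryOn (P.field hθ hp g) (Set.Ici 0) u) {t : ℝ}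
    (ht : 0 ≤ t) :
    ‖u t‖ ^ 2 ≤ ‖u 0‖ ^ 2 * Real.exp (-(2 * P.sigma0 ε D dlow dup) * t)
        + ‖g‖ ^ 2 / (2 * P.sigma0 ε D dlow dup * ε) := by
  have h := P.weightedEnergy_le hθ hp hθ.isSlowWeight (fun _ => le_rfl) hε hσ hζ hu ht
  simpa only [WeightedEll2.weightedEnergy_self] using h

theorem exists_isSolutionOperator (hθ : θ.WS D dlow dup) (hp : 1 < P.p) (hε : 0 < ε)
    (hσ : 0 < P.sigma0 ε D dlow dup) (hζ : 0 < P.ζ) (g : WeightedEll2 θ) :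
    ∃ S : ℝ → WeightedEll2 θ → WeightedEll2 θ, P.IsSolutionOperator g S ∧
      IsContinuousSemigroup S ∧
      ∀ x, IsTrajectoryOn (P.field hθ hp g) (Set.Ici 0) (fun t => S t x) := by
  have hlip := P.exists_lipschitzOnWith_field hθ hp g
  have hdiss : ∀ u : WeightedEll2 θ, inner ℝ u (P.field hθ hp g u)
      ≤ -P.sigma0 ε D dlow dup * ‖u‖ ^ 2 + 1 / (2 * ε) * ‖g‖ ^ 2 := by
    intro u
    have h := P.tsum_weight_mul_re_field_le hθ hp hθ.isSlowWeight (fun _ => le_rfl) hε g u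
    have h2 := mul_nonneg hζ.le (P.tsum_rpow_nonneg (fun n => (θ.pos n).le) u)
    rw [(WeightedEll2.hasSum_real_inner u _).tsum_eq, WeightedEll2.weightedEnergy_self,
      WeightedEll2.weightedEnergy_self] at h
    linarith
  obtain ⟨S, hS, hSt⟩ := exists_semigroup_of_dissipative hlip hσ hdiss
  refine ⟨S, fun u₀ => ⟨?_, fun T _ v hv => ?_⟩, hS, hSt⟩
  · exact (P.isSolutionOn_iff hθ hp g u₀ _ _).2 ⟨hS.zero u₀, hSt u₀⟩
  · obtain ⟨hv0, hv⟩ := (P.isSolutionOn_iff hθ hp g u₀ _ _).1 hv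
    exact hv.eqOn hlip ((hSt u₀).mono Set.Icc_subset_Ici_self) (by simp only [hv0, hS.zero])

theorem tendsto_mul_exp_decay {k : ℝ} (hk : 0 < k) (a : ℝ) :
    Tendsto (fun t : ℝ => a * Real.exp (-k * t)) atTop (𝓝 0) := by
  have h := (Real.tendsto_exp_atBot.comp
    (tendsto_id.const_mul_atTop_of_neg (neg_lt_zero.2 hk))).const_mul a
  simpa using h

theorem isBoundedAbsorbing_closedBall (hθ : θ.WS D dlow dup) (hp : 1 < P.p) (hε : 0 < ε)
    (hσ : 0 < P.sigma0 ε D dlow dup) (hζ : 0 < P.ζ) (hS : IsContinuousSemigroup S)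
    (hSt : ∀ x, IsTrajectoryOn (P.field hθ hp g) (Set.Ici 0) (fun t => S t x)) {ρ₁ : ℝ}
    (hρ : Real.sqrt (‖g‖ ^ 2 / (2 * P.sigma0 ε D dlow dup * ε)) < ρ₁) :
    IsBoundedAbsorbing S (Metric.closedBall 0 ρ₁) := by
  refine ⟨Metric.isBounded_closedBall, fun B hB => ?_⟩
  have hρ0 : 0 < ρ₁ := (Real.sqrt_nonneg _).trans_lt hρ
  rw [Real.sqrt_lt' hρ0] at hρ
  obtain ⟨R, hR⟩ := hB.subset_closedBall 0
  have hev := (tendsto_mul_exp_decay (k := 2 * P.sigma0 ε D dlow dup) (by positivity)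
    (R ^ 2)).eventually (gt_mem_nhds (sub_pos.2 hρ))
  obtain ⟨t₀, ht₀⟩ := eventually_atTop.1 hev
  refine ⟨max t₀ 0, le_max_right _ _, ?_⟩
  rintro t ht _ ⟨x, hx, rfl⟩
  have h1 := P.norm_sq_le hθ hp hε hσ hζ (hSt x) ((le_max_right t₀ 0).trans ht)
  simp only [hS.zero] at h1
  have h2 := ht₀ t ((le_max_left t₀ 0).trans ht)
  have hxR : ‖x‖ ≤ R := mem_closedBall_zero_iff.1 (hR hx)
  have h3 : ‖x‖ ^ 2 * Real.exp (-(2 * P.sigma0 ε D dlow dup) * t)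
      ≤ R ^ 2 * Real.exp (-(2 * P.sigma0 ε D dlow dup) * t) := by gcongr
  rw [mem_closedBall_zero_iff]
  refine (pow_le_pow_iff_left₀ (norm_nonneg _) hρ0.le two_ne_zero).1 ?_
  linarith

theorem isAsymptoticallyCompact (hθ : θ.WS D dlow dup) (hp : 1 < P.p) (hε : 0 < ε)
    (hσ : 0 < P.sigma0 ε D dlow dup) (hζ : 0 < P.ζ) (hS : IsContinuousSemigroup S)
    (hSt : ∀ x, IsTrajectoryOn (P.field hθ hp g) (Set.Ici 0) (fun t => S t x)) :
    IsAsymptoticallyCompact S := by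
  intro B hB r hr
  obtain ⟨t₁, ht₁, habs⟩ := (P.isBoundedAbsorbing_closedBall hθ hp hε hσ hζ hS hSt
    (lt_add_one _)).2 B hB
  set ρ₁ := Real.sqrt (‖g‖ ^ 2 / (2 * P.sigma0 ε D dlow dup * ε)) + 1
  obtain ⟨R, hR⟩ := hB.subset_closedBall 0
  -- The rate `σ` depends on `κ` only, so `κ` is fixed first. Then `K` makes the forcing contribute
  -- less than `r² / 2` and `t₂` does the same for the initial energy; afterwards every state is
  -- within `r` of its truncation to `[-K, K]`.
  obtain ⟨κ, hσκ, hκ⟩ := (((P.tendsto_sigma0 ε D dup hθ.dlow_pos).eventually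
    (lt_mem_nhds hσ)).and self_mem_nhdsWithin).exists
  set σ := P.sigma0 ε (D + dup * (Real.exp κ - 1)) (dlow * Real.exp (-κ)) (dup * Real.exp κ)
  have hr2 : 0 < r ^ 2 / 2 := by positivity
  obtain ⟨K, hK⟩ := (((WeightedEll2.tendsto_weightedEnergy_outerWeight hκ g).div_const
    (2 * σ * ε)).eventually (gt_mem_nhds (by rw [zero_div]; exact hr2))).exists
  obtain ⟨t₂, ht₂⟩ := eventually_atTop.1 ((tendsto_mul_exp_decay (k := 2 * σ) (by positivity)
    (R ^ 2)).eventually (gt_mem_nhds hr2))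
  set w : ℤ → ℝ := fun n => θ n * outerWeight κ K n with hwdef
  have hw : IsSlowWeight w _ _ _ := hθ.isSlowWeight.mul_of_ratio_le hκ.le (outerWeight_pos κ K)
    (fun n => outerWeight_le_exp_mul hκ.le K (abs_intCast_succ_le n))
    (fun n => outerWeight_le_exp_mul hκ.le K (abs_intCast_le_succ n))
  have hw0 : ∀ n, 0 ≤ w n := fun n => (hw.pos n).le
  have hwθ : ∀ n, w n ≤ θ n := fun n =>
    mul_le_of_le_one_right (θ.pos n).le (outerWeight_le_one κ K n)
  set s : Finset ℤ := Finset.Icc (-K) K with hsdef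
  have hs : ∀ n ∉ s, w n = θ n := by
    intro n hn
    rw [hsdef, Finset.mem_Icc, ← abs_le, not_le] at hn
    have : (K : ℝ) ≤ |(n : ℝ)| := by exact_mod_cast hn.le
    rw [hwdef]
    simp only [outerWeight_eq_one hκ.le this, mul_one]
  refine ⟨max t₁ t₂, _, WeightedEll2.isCompact_truncate_image (θ := θ) s ρ₁, ?_⟩
  rintro t ht _ ⟨x, hx, rfl⟩
  have htt₁ := (le_max_left t₁ t₂).trans ht
  have hball : ‖S t x‖ ≤ ρ₁ := mem_closedBall_zero_iff.1 (habs t htt₁ ⟨x, hx, rfl⟩)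
  refine Metric.mem_thickening_iff.2 ⟨WeightedEll2.truncate θ s (S t x), ⟨_, ?_, rfl⟩, ?_⟩
  · intro n _
    exact mem_closedBall_zero_iff.2 (((S t x).norm_apply_le n).trans hball)
  · have h1 := P.weightedEnergy_le hθ hp hw hwθ hε hσκ hζ (hSt x) (ht₁.trans htt₁)
    simp only [hS.zero] at h1
    have h2 := ht₂ t ((le_max_right t₁ t₂).trans ht)
    have hxR : ‖x‖ ≤ R := mem_closedBall_zero_iff.1 (hR hx)
    have h3 : weightedEnergy w x ≤ R ^ 2 :=
      (WeightedEll2.weightedEnergy_le_norm_sq hw0 hwθ x).trans (by gcongr)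
    have h4 := mul_le_mul_of_nonneg_right h3 (Real.exp_pos (-(2 * σ) * t)).le
    have h5 := WeightedEll2.norm_sub_truncate_sq_le hw0 hwθ hs (S t x)
    rw [dist_eq_norm]
    refine (pow_lt_pow_iff_left₀ (norm_nonneg _) hr.le two_ne_zero).1 ?_
    linarith

/-- Every point of `Y` is `S 1` of another, so energies on `Y` are at most `M`. Every point is also
`S t` of a point of `Y` for arbitrarily large `t`, so the contribution of `M` decays away. -/
theorem weightedEnergy_le_of_isFunctionalInvariant {w : ℤ → ℝ} {D₁ dlow₁ dup₁ : ℝ}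
    (hθ : θ.WS D dlow dup) (hp : 1 < P.p)
    (hw : IsSlowWeight w D₁ dlow₁ dup₁) (hwθ : ∀ n, w n ≤ θ n) (hws : Summable w) (hε : 0 < ε)
    (hσ : 0 < P.sigma0 ε D₁ dlow₁ dup₁) (hζ : 0 < P.ζ) (hS : IsContinuousSemigroup S)
    (hSt : ∀ x, IsTrajectoryOn (P.field hθ hp g) (Set.Ici 0) (fun t => S t x))
    {Y : Set (WeightedEll2 θ)} (hY : IsFunctionalInvariant S Y) {y : WeightedEll2 θ} (hy : y ∈ Y) :
    weightedEnergy w y ≤ weightedEnergy w g / (2 * P.sigma0 ε D₁ dlow₁ dup₁ * ε) := by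
  obtain ⟨M, hM⟩ := P.exists_weightedEnergy_at_one_le hθ hp hw hwθ hws hε hσ hζ g
  have hYM : ∀ z ∈ Y, weightedEnergy w z ≤ M := by
    intro z hz
    rw [← hY 1 zero_le_one] at hz
    obtain ⟨x, -, rfl⟩ := hz
    exact hM _ (hSt x)
  have hlim := (tendsto_mul_exp_decay (k := 2 * P.sigma0 ε D₁ dlow₁ dup₁) (by positivity)
    M).add_const (weightedEnergy w g / (2 * P.sigma0 ε D₁ dlow₁ dup₁ * ε))
  rw [zero_add] at hlim
  refine ge_of_tendsto hlim ?_
  filter_upwards [eventually_ge_atTop 0] with t ht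
  rw [← hY t ht] at hy
  obtain ⟨x, hx, rfl⟩ := hy
  have h1 := P.weightedEnergy_le hθ hp hw hwθ hε hσ hζ (hSt x) ht
  simp only [hS.zero] at h1
  have h2 := mul_le_mul_of_nonneg_right (hYM x hx)
    (Real.exp_pos (-(2 * P.sigma0 ε D₁ dlow₁ dup₁) * t)).le
  linarith

/-- Functional invariant sets are bounded, because the nonlinear damping prevents unbounded
orbits from existing for all negative times. -/
theorem isBounded_of_isFunctionalInvariant (hθ : θ.WS D dlow dup) (hp : 1 < P.p) (hε : 0 < ε)
    (hσ : 0 < P.sigma0 ε D dlow dup) (hζ : 0 < P.ζ) (hS : IsContinuousSemigroup S)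
    (hSt : ∀ x, IsTrajectoryOn (P.field hθ hp g) (Set.Ici 0) (fun t => S t x))
    {Y : Set (WeightedEll2 θ)} (hY : IsFunctionalInvariant S Y) : Bornology.IsBounded Y := by
  -- The factor `2` is given up because the tilted weights are only required to have more than half
  -- the rate; this makes the bound uniform in `κ`.
  set M := ‖g‖ ^ 2 / (P.sigma0 ε D dlow dup * ε) with hM
  refine (Metric.isBounded_closedBall (x := (0 : WeightedEll2 θ)) (r := Real.sqrt M)).subset ?_
  intro y hy
  rw [mem_closedBall_zero_iff]
  refine Real.le_sqrt_of_sq_le ?_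
  rw [WeightedEll2.norm_sq_eq]
  refine y.summable_sq.tsum_le_of_sum_le fun F => ?_
  -- The level exceeds `θ` on `F`, so truncation leaves the partial sum over `F` unchanged while the
  -- tilted weight is summable.
  set c := 1 + ∑ n ∈ F, θ n with hc
  have hsum0 : 0 ≤ ∑ n ∈ F, θ n := Finset.sum_nonneg fun n _ => (θ.pos n).le
  have hc0 : 0 < c := by linarith
  have hcF : ∀ n ∈ F, min (θ n) c = θ n := fun n hn => min_eq_left (by
    have := Finset.single_le_sum (fun m _ => (θ.pos m).le) hn
    linarith)
  have key : ∀ᶠ κ in 𝓝[>] (0 : ℝ),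
      ∑ n ∈ F, min (θ n) c * Real.exp (-κ * |(n : ℝ)|) * ‖y n‖ ^ 2 ≤ M := by
    filter_upwards [(P.tendsto_sigma0 ε D dup hθ.dlow_pos).eventually
      (lt_mem_nhds (half_lt_self hσ)), self_mem_nhdsWithin] with κ hσκ hκ
    rw [Set.mem_Ioi] at hκ
    set w : ℤ → ℝ := fun n => min (θ n) c * Real.exp (-κ * |(n : ℝ)|) with hwdef
    have hw : IsSlowWeight w _ _ _ := (hθ.isSlowWeight_min hc0).mul_of_ratio_le hκ.le
      (fun n => Real.exp_pos _)
      (fun n => exp_neg_mul_abs_le_exp_mul hκ.le (abs_intCast_le_succ n))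
      (fun n => exp_neg_mul_abs_le_exp_mul hκ.le (abs_intCast_succ_le n))
    have hw0 : ∀ n, 0 ≤ w n := fun n => (hw.pos n).le
    have hexp : ∀ n : ℤ, Real.exp (-κ * |(n : ℝ)|) ≤ 1 := fun n =>
      Real.exp_le_one_iff.2 (by nlinarith [abs_nonneg (n : ℝ)])
    have hwθ : ∀ n, w n ≤ θ n := fun n =>
      (mul_le_of_le_one_right (lt_min (θ.pos n) hc0).le (hexp n)).trans (min_le_left _ _)
    have hws : Summable w := Summable.of_nonneg_of_le hw0
      (fun n => mul_le_mul_of_nonneg_right (min_le_right _ _) (Real.exp_pos _).le)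
      ((summable_exp_neg_mul_abs hκ).mul_left c)
    have h1 := P.weightedEnergy_le_of_isFunctionalInvariant hθ hp hw hwθ hws hε
      ((half_pos hσ).trans hσκ) hζ hS hSt hY hy
    have h2 := (WeightedEll2.summable_weight_mul_sq hw0 hwθ y).sum_le_tsum F
      fun n _ => mul_nonneg (hw0 n) (sq_nonneg _)
    refine h2.trans (h1.trans ?_)
    have h3 := WeightedEll2.weightedEnergy_le_norm_sq hw0 hwθ g
    rw [hM]
    have h4 : 0 < P.sigma0 ε D dlow dup * ε := mul_pos hσ hε
    gcongr
    linarith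
  have hlim : Tendsto (fun κ : ℝ =>
      ∑ n ∈ F, min (θ n) c * Real.exp (-κ * |(n : ℝ)|) * ‖y n‖ ^ 2) (𝓝[>] 0)
      (𝓝 (∑ n ∈ F, min (θ n) c * Real.exp (-0 * |(n : ℝ)|) * ‖y n‖ ^ 2)) :=
    (Continuous.tendsto (by fun_prop) 0).mono_left nhdsWithin_le_nhds
  have h := le_of_tendsto hlim key
  refine le_trans (le_of_eq (Finset.sum_congr rfl fun n hn => ?_)) h
  rw [hcF n hn, neg_zero, zero_mul, Real.exp_zero, mul_one]

end LatticeParams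

end

theorem theorem4p1 (θ : LatticeWeight) (D dlow dup : ℝ) (hθ : θ.WS D dlow dup)
    (P : LatticeParams) (hp : 1 < P.p) (ε : ℝ) (hε : 0 < ε)
    (hσ : 0 < P.sigma0 ε D dlow dup) (hζ : 0 < P.ζ) (g : WeightedEll2 θ) :
    ∃ S : ℝ → WeightedEll2 θ → WeightedEll2 θ,
      P.IsSolutionOperator g S ∧ IsContinuousSemigroup S ∧
      ∃ A : Set (WeightedEll2 θ),
        IsGlobalAttractor S A ∧ IsConnected A ∧
        (∀ Y : Set (WeightedEll2 θ), IsFunctionalInvariant S Y → Y ⊆ A) ∧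
        ∀ ρ₁ : ℝ, Real.sqrt (‖g‖ ^ 2 / (2 * P.sigma0 ε D dlow dup * ε)) < ρ₁ →
          IsBoundedAbsorbing S (Metric.closedBall 0 ρ₁) ∧
          A = omegaLimit atTop S (Metric.closedBall 0 ρ₁) ∧
          A ⊆ Metric.closedBall 0 ρ₁ := by

  obtain ⟨S, hSol, hS, hSt⟩ := P.exists_isSolutionOperator hθ hp hε hσ hζ g
  have hAC := P.isAsymptoticallyCompact hθ hp hε hσ hζ hS hSt
  have habs := fun {ρ₁ : ℝ} => P.isBoundedAbsorbing_closedBall (ρ₁ := ρ₁) hθ hp hε hσ hζ hS hSt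
  set ρ := Real.sqrt (‖g‖ ^ 2 / (2 * P.sigma0 ε D dlow dup * ε)) with hρ
  have hρ0 : 0 ≤ ρ := Real.sqrt_nonneg _
  have hAtt : ∀ ρ₁ : ℝ, ρ < ρ₁ →
      IsGlobalAttractor S (omegaLimit atTop S (Metric.closedBall 0 ρ₁)) := fun ρ₁ h =>
    hAC.isGlobalAttractor_omegaLimit hS (habs h)
  have hmax : ∀ A, IsGlobalAttractor S A → ∀ Y, IsFunctionalInvariant S Y → Y ⊆ A :=
    fun A hA Y hY => hA.subset_of_isBounded hY
      (P.isBounded_of_isFunctionalInvariant hθ hp hε hσ hζ hS hSt hY)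
  have hA := hAtt (ρ + 1) (lt_add_one ρ)
  refine ⟨S, hSol, hS, _, hA, ⟨?_, ?_⟩, hmax _ hA, fun ρ₁ hρ₁ => ⟨habs hρ₁, ?_, ?_⟩⟩
  · exact hAC.nonempty_omegaLimit Metric.isBounded_closedBall
      (Metric.nonempty_closedBall.2 (by linarith))
  · let : NormedSpace ℝ (WeightedEll2 θ) := NormedSpace.complexToReal
    exact hA.isPreconnected hS (habs (lt_add_one ρ))
      (convex_closedBall (0 : WeightedEll2 θ) (ρ + 1)).isPreconnected
  -- Each radius yields a global attractor, and by maximality any two of them contain each other.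
  · exact (hmax _ (hAtt ρ₁ hρ₁) _ hA.invariant).antisymm (hmax _ hA _ (hAtt ρ₁ hρ₁).invariant)
  · exact hA.invariant.subset_of_isBoundedAbsorbing hA.compact.isBounded (habs hρ₁)
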